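/- **Setting.** For a set $X$ let $W(X)$ be the set of finite words in $X$, including the empty word $\varnothing$; write $|w|$ for the length of $w$ and $vw$ for concatenation. A *tensor scheme* $D$ consists of sets $\mathrm{Ob}\,D$, $\mathrm{Mor}\,D$ and maps $\mathrm{dom},\mathrm{cod}:\mathrm{Mor}\,D\to W(\mathrm{Ob}\,D)$; a morphism of tensor schemes is a map on objects and a map on morphisms compatible with $\mathrm{dom}$ and $\mathrm{cod}$. A strict tensor category is a small strict monoidal category. The underlying tensor scheme $U(V)$ of a strict tensor category $V$ has the objects of $V$ as objects; its morphisms are the prime diagrams in $V$, i.e. triples $(v,w,f)$ with $v,w\in W(\mathrm{Ob}\,V)$ and $f:\otimes v\to\otimes w$ a morphism of $V$, with domain $v$ and codomain $w$. $U$ is a functor from strict tensor categories and strict tensor functors to tensor schemes; its left adjoint $F$ sends $D$ to the free strict tensor category $F(D)$ on $D$, whose objects are the words in $\mathrm{Ob}\,D$, with concatenation as tensor product and $\varnothing$ as unit. Let $T=UF$ be the resulting monad. A *tensor manifold structure* ($T$-algebra structure) on $D$ is a morphism $\varepsilon:T(D)\to D$ making $D$ an Eilenberg–Moore algebra of $T$.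 A *linear partition* $I$ of a word of length $\|I\|$ is a division of it into $|I|$ consecutive, possibly empty, blocks; it is identified with the list of its block lengths. $I\otimes J$ is juxtaposition, the finest linear partition has only blocks of length $1$, and if $P$ is a linear partition of the sequence of blocks of $Q$ (i.e. $\|P\|=|Q|$), $P\triangleleft Q$ is obtained from $Q$ by uniting the blocks of $Q$ that lie in one block of $P$. A *system of operations* on $D$ consists of: a morphism $\mathrm{Id}_w$ for each word $w$; a morphism $f\otimes g$ for all morphisms $f,g$; a morphism $g\circ f$ whenever $\mathrm{cod} f=\mathrm{dom}\,g$; and a morphism $*^I_O(f)$ (fusion) for linear partitions $I,O$ and every $f$ with $|\mathrm{dom} f|=\|I\|$, $|\mathrm{cod} f|=\|O\|$. It is *lawful* if, whenever the left-hand sides below are defined: 1. $\mathrm{dom}\,\mathrm{Id}_w=\mathrm{cod}\,\mathrm{Id}_w=w$; $\mathrm{dom}(f\otimes g)=\mathrm{dom} f\,\mathrm{dom}\, g$ and $\mathrm{cod}(f\otimes g)=\mathrm{cod} f\,\mathrm{cod}\, g$; $\mathrm{dom}(g\circ f)=\mathrm{dom} f$, $\mathrm{cod}(g\circ f)=\mathrm{cod}\,g$;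 $|\mathrm{dom}\,{*^I_O}(f)|=|I|$, $|\mathrm{cod}\,{*^I_O}(f)|=|O|$; 2. $(f\otimes g)\otimes h=f\otimes(g\otimes h)$ and $\mathrm{Id}_\varnothing\otimes f=f=f\otimes\mathrm{Id}_\varnothing$; 3. $k\circ(g\circ f)=(k\circ g)\circ f$ and $\mathrm{Id}_{\mathrm{cod} f}\circ f=f=f\circ\mathrm{Id}_{\mathrm{dom} f}$; 4. $(g_1\circ f_1)\otimes(g_2\circ f_2)=(g_1\otimes g_2)\circ(f_1\otimes f_2)$; 5. $\mathrm{Id}_{x_1\cdots x_m}=\mathrm{Id}_{x_1}\otimes\cdots\otimes\mathrm{Id}_{x_m}$; 6. $*^{I_1}_{O_1}(*^{I_2}_{O_2}(f))=*^{I_1\triangleleft I_2}_{O_1\triangleleft O_2}(f)$, and $*^I_O(f)=f$ if $I$ and $O$ are the finest linear partitions; 7. $*^{I_1\otimes I_2}_{O_1\otimes O_2}(f\otimes g)=*^{I_1}_{O_1}(f)\otimes *^{I_2}_{O_2}(g)$ whenever the right-hand side is defined; 8. $*^I_O(g\circ f)=*^J_O(g)\circ *^I_J(f)$ for every linear partition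 $J$ with $\|J\|=|\mathrm{cod} f|$; in particular $\mathrm{cod}\,{*^I_J}(f)=\mathrm{dom}\,{*^J_O}(g)$; 9. $*^I_I(\mathrm{Id}_w)$ is the identity morphism of its domain. A tensor manifold structure $\varepsilon$ on $D$ *induces* the following system of operations: $\mathrm{Id}_w$, $f\otimes g$ and $g\circ f$ are the values of $\varepsilon$ at the prime diagrams in $F(D)$ given by the identity of $w$, by the tensor product and by the composite in $F(D)$ of the generators $f$ and $g$, with domain and codomain divided into one-letter words; $*^I_O(f)$ is the value of $\varepsilon$ at the prime diagram given by the generator $f$ with its domain divided by $I$ and its codomain divided by $O$. **Theorem.** (i) For every tensor manifold structure on a tensor scheme $D$, the induced system of operations is lawful. Conversely, every lawful system of operations on $D$ is induced by a unique tensor manifold structure on $D$. Hence tensor manifold structures on $D$ are equivalent to lawful systems of operations on $D$. (ii) Let $D$, $E$ be tensor schemes equipped with tensor manifold structures and $\varphi:D\to E$ a morphism of tensor schemes. Then $\varphi$ is a morphism of $T$-algebras if and only if it preserves identity morphisms, tensor products, compositions and fusions: $\varphi(\mathrm{Id}_{x_1\cdots x_m})=\mathrm{Id}_{\varphi(x_1)\cdots\varphi(x_m)}$,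 $\varphi(f\otimes g)=\varphi(f)\otimes\varphi(g)$, $\varphi(g\circ f)=\varphi(g)\circ\varphi(f)$ and $\varphi(*^I_O(f))=*^I_O(\varphi(f))$ whenever the arguments are defined. -/

import Mathlib

open CategoryTheory

universe u

/-! ## Tensor schemes -/

/-- A tensor scheme: a set of objects, a set of morphisms, and maps assigning to each morphism its
source and its target, which are (possibly empty) words in the objects. -/
structure TensorScheme : Type (u + 1) where
  Ob : Type u
  Mor : Type u
  s : Mor → List Ob
  t : Mor → List Ob

namespace TensorScheme

/-- A morphism of tensor schemes: a map on objects and a map on morphisms, compatible with sources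
and targets. -/
@[ext]
structure Hom (D E : TensorScheme.{u}) : Type u where
  obj : D.Ob → E.Ob
  mor : D.Mor → E.Mor
  s_mor : ∀ f, E.s (mor f) = (D.s f).map obj
  t_mor : ∀ f, E.t (mor f) = (D.t f).map obj

instance : Category TensorScheme.{u} where
  Hom := Hom
  id D := ⟨fun x => x, fun f => f, fun f => by simp, fun f => by simp⟩
  comp φ ψ := ⟨fun x => ψ.obj (φ.obj x), fun f => ψ.mor (φ.mor f),
    fun f => by rw [ψ.s_mor, φ.s_mor, List.map_map]; rfl,
    fun f => by rw [ψ.t_mor, φ.t_mor, List.map_map]; rfl⟩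

@[ext]
theorem hom_ext {D E : TensorScheme.{u}} {φ ψ : D ⟶ E} (ho : ∀ x, φ.obj x = ψ.obj x)
    (hm : ∀ f, φ.mor f = ψ.mor f) : φ = ψ :=
  Hom.ext (funext ho) (funext hm)

end TensorScheme

/-! ## Strict tensor categories -/

/-- A (small) strict tensor category, i.e. a strict monoidal category, presented by its set of
objects and its set of all morphisms. Here `comp g f _` is `g ∘ f`, defined when `t f = s g`. -/
structure StrictTensorCat : Type (u + 1) where
  Ob : Type u
  Mor : Type u
  s : Mor → Ob
  t : Mor → Ob
  id : Ob → Mor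
  comp : (g f : Mor) → t f = s g → Mor
  tensorOb : Ob → Ob → Ob
  unit : Ob
  tensor : Mor → Mor → Mor
  s_id : ∀ x, s (id x) = x
  t_id : ∀ x, t (id x) = x
  s_comp : ∀ g f h, s (comp g f h) = s f
  t_comp : ∀ g f h, t (comp g f h) = t g
  id_comp : ∀ x f h, comp (id x) f h = f
  comp_id : ∀ x f h, comp f (id x) h = f
  assoc : ∀ k g f h₁ h₂ h₃ h₄, comp k (comp g f h₁) h₂ = comp (comp k g h₃) f h₄
  tensorOb_assoc : ∀ x y z, tensorOb (tensorOb x y) z = tensorOb x (tensorOb y z)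
  unit_tensorOb : ∀ x, tensorOb unit x = x
  tensorOb_unit : ∀ x, tensorOb x unit = x
  s_tensor : ∀ f g, s (tensor f g) = tensorOb (s f) (s g)
  t_tensor : ∀ f g, t (tensor f g) = tensorOb (t f) (t g)
  tensor_id : ∀ x y, tensor (id x) (id y) = id (tensorOb x y)
  interchange : ∀ g₁ f₁ g₂ f₂ h₁ h₂ h,
    tensor (comp g₁ f₁ h₁) (comp g₂ f₂ h₂) = comp (tensor g₁ g₂) (tensor f₁ f₂) h
  tensor_assoc : ∀ f g h, tensor (tensor f g) h = tensor f (tensor g h)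
  unit_tensor : ∀ f, tensor (id unit) f = f
  tensor_unit : ∀ f, tensor f (id unit) = f

namespace StrictTensorCat

/-- The tensor product of a word of objects; the empty word has tensor product the unit. -/
def prod (V : StrictTensorCat.{u}) (w : List V.Ob) : V.Ob := w.foldr V.tensorOb V.unit

theorem prod_nil (V : StrictTensorCat.{u}) : V.prod [] = V.unit := rfl

theorem prod_cons (V : StrictTensorCat.{u}) (x : V.Ob) (w : List V.Ob) :
    V.prod (x :: w) = V.tensorOb x (V.prod w) := rfl

theorem prod_append (V : StrictTensorCat.{u}) (v w : List V.Ob) :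
    V.prod (v ++ w) = V.tensorOb (V.prod v) (V.prod w) := by
  induction v with
  | nil => rw [List.nil_append, prod_nil, V.unit_tensorOb]
  | cons x v ih => rw [List.cons_append, prod_cons, prod_cons, ih, V.tensorOb_assoc]

theorem prod_singleton (V : StrictTensorCat.{u}) (x : V.Ob) : V.prod [x] = x := V.tensorOb_unit x

/-- A strict tensor functor. -/
@[ext]
structure Hom (V W : StrictTensorCat.{u}) : Type u where
  obj : V.Ob → W.Ob
  mor : V.Mor → W.Mor
  s_mor : ∀ f, W.s (mor f) = obj (V.s f)
  t_mor : ∀ f, W.t (mor f) = obj (V.t f)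
  map_id : ∀ x, mor (V.id x) = W.id (obj x)
  map_comp : ∀ g f h, mor (V.comp g f h) =
    W.comp (mor g) (mor f) ((t_mor f).trans ((congrArg obj h).trans (s_mor g).symm))
  map_tensorOb : ∀ x y, obj (V.tensorOb x y) = W.tensorOb (obj x) (obj y)
  map_unit : obj V.unit = W.unit
  map_tensor : ∀ f g, mor (V.tensor f g) = W.tensor (mor f) (mor g)

/-- The category of small strict tensor categories and strict tensor functors. -/
instance : Category StrictTensorCat.{u} where
  Hom := Hom
  id V := ⟨fun x => x, fun f => f, fun _ => rfl, fun _ => rfl, fun _ => rfl, fun _ _ _ => rfl,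
    fun _ _ => rfl, rfl, fun _ _ => rfl⟩
  comp K L :=
    { obj := fun x => L.obj (K.obj x)
      mor := fun f => L.mor (K.mor f)
      s_mor := fun f => by rw [L.s_mor, K.s_mor]
      t_mor := fun f => by rw [L.t_mor, K.t_mor]
      map_id := fun x => by rw [K.map_id, L.map_id]
      map_comp := fun g f h => by rw [K.map_comp, L.map_comp]
      map_tensorOb := fun x y => by rw [K.map_tensorOb, L.map_tensorOb]
      map_unit := by rw [K.map_unit, L.map_unit]
      map_tensor := fun f g => by rw [K.map_tensor, L.map_tensor] }

@[ext]
theorem hom_ext {V W : StrictTensorCat.{u}} {K L : V ⟶ W} (ho : ∀ x, K.obj x = L.obj x)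
    (hm : ∀ f, K.mor f = L.mor f) : K = L :=
  Hom.ext (funext ho) (funext hm)

theorem map_prod {V W : StrictTensorCat.{u}} (K : V ⟶ W) (w : List V.Ob) :
    K.obj (V.prod w) = W.prod (w.map K.obj) := by
  induction w with
  | nil => exact K.map_unit
  | cons x w ih => rw [prod_cons, K.map_tensorOb, ih]; rfl

theorem comp_congr (V : StrictTensorCat.{u}) {g g' f f' : V.Mor} (h : V.t f = V.s g)
    (h' : V.t f' = V.s g') (hg : g = g') (hf : f = f') : V.comp g f h = V.comp g' f' h' := by
  subst hg hf; rfl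

/-! ## The underlying tensor scheme of a strict tensor category -/

/-- A prime diagram in `V`: a word `dom`, a word `cod` and a morphism of `V` from the tensor product
of `dom` to the tensor product of `cod`. -/
@[ext]
structure Prim (V : StrictTensorCat.{u}) : Type u where
  dom : List V.Ob
  cod : List V.Ob
  mor : V.Mor
  s_mor : V.s mor = V.prod dom
  t_mor : V.t mor = V.prod cod

/-- The underlying tensor scheme functor `U`: the objects of `U V` are the objects of `V` and the
morphisms of `U V` are the prime diagrams in `V`. -/
def U : StrictTensorCat.{u} ⥤ TensorScheme.{u} where
  obj V := ⟨V.Ob, Prim V, Prim.dom, Prim.cod⟩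
  map {V W} K :=
    { obj := K.obj
      mor := fun p => ⟨p.dom.map K.obj, p.cod.map K.obj, K.mor p.mor,
        by rw [K.s_mor, p.s_mor, map_prod], by rw [K.t_mor, p.t_mor, map_prod]⟩
      s_mor := fun _ => rfl
      t_mor := fun _ => rfl }
  map_id V := by
    apply TensorScheme.hom_ext
    · intro x; rfl
    · intro p; exact Prim.ext (List.map_id _) (List.map_id _) rfl
  map_comp K L := by
    apply TensorScheme.hom_ext
    · intro x; rfl
    · intro p
      have e : ∀ w : List _, w.map (fun x => L.obj (K.obj x)) = (w.map K.obj).map L.obj :=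
        fun w => by rw [List.map_map]; rfl
      exact Prim.ext (e _) (e _) rfl

end StrictTensorCat

/-! ## The free strict tensor category on a tensor scheme -/

/-- Formal expressions for the morphisms of the free strict tensor category on `D`, built from the
morphisms of `D`, identities, composition and tensor product. -/
inductive FreeTerm (D : TensorScheme.{u}) : List D.Ob → List D.Ob → Type u
  | gen (f : D.Mor) : FreeTerm D (D.s f) (D.t f)
  | id (w : List D.Ob) : FreeTerm D w w
  | comp {a b b' c : List D.Ob} (g : FreeTerm D b' c) (f : FreeTerm D a b) (h : b = b') :
      FreeTerm D a c
  | tensor {a b c d : List D.Ob} (f : FreeTerm D a b) (g : FreeTerm D c d) :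
      FreeTerm D (a ++ c) (b ++ d)

/-- The congruence on formal expressions generated by the axioms of a strict tensor category. -/
inductive FreeRel (D : TensorScheme.{u}) :
    {a b c d : List D.Ob} → FreeTerm D a b → FreeTerm D c d → Prop
  | refl {a b} (f : FreeTerm D a b) : FreeRel D f f
  | symm {a b c d} {f : FreeTerm D a b} {g : FreeTerm D c d} : FreeRel D f g → FreeRel D g f
  | trans {a b c d k l} {f : FreeTerm D a b} {g : FreeTerm D c d} {h : FreeTerm D k l} :
      FreeRel D f g → FreeRel D g h → FreeRel D f h
  | comp_congr {a b b' c k l l' m} {g : FreeTerm D b' c} {f : FreeTerm D a b}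
      {g' : FreeTerm D l' m} {f' : FreeTerm D k l} (h : b = b') (h' : l = l') :
      FreeRel D g g' → FreeRel D f f' → FreeRel D (.comp g f h) (.comp g' f' h')
  | tensor_congr {a b c d k l m n} {f : FreeTerm D a b} {g : FreeTerm D c d}
      {f' : FreeTerm D k l} {g' : FreeTerm D m n} :
      FreeRel D f f' → FreeRel D g g' → FreeRel D (.tensor f g) (.tensor f' g')
  | id_comp {a b w} (f : FreeTerm D a b) (h : b = w) : FreeRel D (.comp (.id w) f h) f
  | comp_id {a b w} (f : FreeTerm D a b) (h : w = a) : FreeRel D (.comp f (.id w) h) f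
  | assoc {a b b' c c' d} (k : FreeTerm D c' d) (g : FreeTerm D b' c) (f : FreeTerm D a b)
      (h : b = b') (h' : c = c') :
      FreeRel D (.comp k (.comp g f h) h') (.comp (.comp k g h') f h)
  | tensor_id (v w : List D.Ob) : FreeRel D (.tensor (.id v) (.id w)) (.id (v ++ w))
  | interchange {a₁ b₁ b₁' c₁ a₂ b₂ b₂' c₂} (g₁ : FreeTerm D b₁' c₁) (f₁ : FreeTerm D a₁ b₁)
      (g₂ : FreeTerm D b₂' c₂) (f₂ : FreeTerm D a₂ b₂) (h₁ : b₁ = b₁') (h₂ : b₂ = b₂')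
      (h : b₁ ++ b₂ = b₁' ++ b₂') :
      FreeRel D (.tensor (.comp g₁ f₁ h₁) (.comp g₂ f₂ h₂))
        (.comp (.tensor g₁ g₂) (.tensor f₁ f₂) h)
  | tensor_assoc {a b c d k l} (f : FreeTerm D a b) (g : FreeTerm D c d) (h : FreeTerm D k l) :
      FreeRel D (.tensor (.tensor f g) h) (.tensor f (.tensor g h))
  | unit_tensor {a b} (f : FreeTerm D a b) : FreeRel D (.tensor (.id []) f) f
  | tensor_unit {a b} (f : FreeTerm D a b) : FreeRel D (.tensor f (.id [])) f

theorem FreeRel.endpoints {D : TensorScheme.{u}} {a b c d : List D.Ob} {f : FreeTerm D a b}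
    {g : FreeTerm D c d} (h : FreeRel D f g) : a = c ∧ b = d := by
  induction h with
  | refl f => exact ⟨rfl, rfl⟩
  | symm _ ih => exact ⟨ih.1.symm, ih.2.symm⟩
  | trans _ _ ih₁ ih₂ => exact ⟨ih₁.1.trans ih₂.1, ih₁.2.trans ih₂.2⟩
  | comp_congr _ _ _ _ ih₁ ih₂ => exact ⟨ih₂.1, ih₁.2⟩
  | tensor_congr _ _ ih₁ ih₂ => exact ⟨by rw [ih₁.1, ih₂.1], by rw [ih₁.2, ih₂.2]⟩
  | id_comp f h => exact ⟨rfl, h.symm⟩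
  | comp_id f h => exact ⟨h, rfl⟩
  | assoc => exact ⟨rfl, rfl⟩
  | tensor_id => exact ⟨rfl, rfl⟩
  | interchange => exact ⟨rfl, rfl⟩
  | tensor_assoc => exact ⟨List.append_assoc _ _ _, List.append_assoc _ _ _⟩
  | unit_tensor => exact ⟨rfl, rfl⟩
  | tensor_unit => exact ⟨List.append_nil _, List.append_nil _⟩

/-- A formal expression together with its source and target. -/
structure FreeArrow (D : TensorScheme.{u}) : Type u where
  src : List D.Ob
  tgt : List D.Ob
  term : FreeTerm D src tgt

instance FreeArrow.setoid (D : TensorScheme.{u}) : Setoid (FreeArrow D) where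
  r f g := FreeRel D f.term g.term
  iseqv := ⟨fun f => .refl f.term, fun h => .symm h, fun h₁ h₂ => .trans h₁ h₂⟩

/-- The morphisms of the free strict tensor category on `D`. -/
def FreeMor (D : TensorScheme.{u}) : Type u := Quotient (FreeArrow.setoid D)

namespace FreeMor

variable {D : TensorScheme.{u}}

/-- The morphism represented by a formal expression. -/
def mk {a b : List D.Ob} (f : FreeTerm D a b) : FreeMor D := Quotient.mk _ ⟨a, b, f⟩

theorem sound {a b c d : List D.Ob} {f : FreeTerm D a b} {g : FreeTerm D c d}
    (h : FreeRel D f g) : mk f = mk g := Quotient.sound h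

theorem ind {P : FreeMor D → Prop} (h : ∀ {a b : List D.Ob} (f : FreeTerm D a b), P (mk f)) :
    ∀ f, P f := fun f => Quotient.inductionOn f fun f => h f.term

def src (f : FreeMor D) : List D.Ob :=
  Quotient.lift FreeArrow.src (fun _ _ h => (FreeRel.endpoints h).1) f

def tgt (f : FreeMor D) : List D.Ob :=
  Quotient.lift FreeArrow.tgt (fun _ _ h => (FreeRel.endpoints h).2) f

theorem src_mk {a b : List D.Ob} (f : FreeTerm D a b) : src (mk f) = a := rfl

theorem tgt_mk {a b : List D.Ob} (f : FreeTerm D a b) : tgt (mk f) = b := rfl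

open Classical in
/-- Composition of morphisms extended by a dummy value to pairs that are not composable. -/
noncomputable def compAux (g f : FreeMor D) : FreeMor D :=
  Quotient.lift₂
    (fun g f : FreeArrow D =>
      if h : f.tgt = g.src then mk (FreeTerm.comp g.term f.term h) else mk g.term)
    (by
      intro g f g' f' hg hf
      have eg := FreeRel.endpoints hg
      have ef := FreeRel.endpoints hf
      by_cases h : f.tgt = g.src
      · have h' : f'.tgt = g'.src := by rw [← ef.2, ← eg.1, h]
        simp only [h, h', dif_pos]
        exact sound (.comp_congr h h' hg hf)
      · have h' : ¬ f'.tgt = g'.src := by rwa [← ef.2, ← eg.1]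
        simp only [h, h', dif_neg, not_false_eq_true]
        exact sound hg) g f

/-- Composition `g ∘ f`. -/
noncomputable def comp (g f : FreeMor D) (_ : tgt f = src g) : FreeMor D := compAux g f

theorem comp_mk {a b b' c : List D.Ob} (g : FreeTerm D b' c) (f : FreeTerm D a b)
    (h : tgt (mk f) = src (mk g)) :
    comp (mk g) (mk f) h = mk (.comp g f (show b = b' from h)) :=
  dif_pos h

def tensor (f g : FreeMor D) : FreeMor D :=
  Quotient.lift₂ (fun f g : FreeArrow D => mk (.tensor f.term g.term))
    (fun _ _ _ _ hf hg => sound (.tensor_congr hf hg)) f g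

theorem tensor_mk {a b c d : List D.Ob} (f : FreeTerm D a b) (g : FreeTerm D c d) :
    tensor (mk f) (mk g) = mk (.tensor f g) := rfl

end FreeMor

/-- The free strict tensor category on a tensor scheme `D`: its objects are the words in the objects
of `D`, the tensor product of objects is concatenation, and the unit is the empty word. -/
noncomputable def freeTensorCat (D : TensorScheme.{u}) : StrictTensorCat.{u} where
  Ob := List D.Ob
  Mor := FreeMor D
  s := FreeMor.src
  t := FreeMor.tgt
  id w := .mk (.id w)
  comp := FreeMor.comp
  tensorOb v w := v ++ w
  unit := []
  tensor := FreeMor.tensor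
  s_id _ := rfl
  t_id _ := rfl
  s_comp g f h := by
    induction g using FreeMor.ind
    induction f using FreeMor.ind
    rw [FreeMor.comp_mk]; rfl
  t_comp g f h := by
    induction g using FreeMor.ind
    induction f using FreeMor.ind
    rw [FreeMor.comp_mk]; rfl
  id_comp x f h := by
    induction f using FreeMor.ind
    rw [FreeMor.comp_mk]; exact FreeMor.sound (.id_comp _ _)
  comp_id x f h := by
    induction f using FreeMor.ind
    rw [FreeMor.comp_mk]; exact FreeMor.sound (.comp_id _ _)
  assoc k g f h₁ h₂ h₃ h₄ := by
    induction k using FreeMor.ind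
    induction g using FreeMor.ind
    induction f using FreeMor.ind
    simp only [FreeMor.comp_mk]
    exact FreeMor.sound (.assoc _ _ _ _ _)
  tensorOb_assoc := List.append_assoc
  unit_tensorOb _ := rfl
  tensorOb_unit := List.append_nil
  s_tensor f g := by
    induction f using FreeMor.ind
    induction g using FreeMor.ind
    rfl
  t_tensor f g := by
    induction f using FreeMor.ind
    induction g using FreeMor.ind
    rfl
  tensor_id v w := FreeMor.sound (.tensor_id v w)
  interchange g₁ f₁ g₂ f₂ h₁ h₂ h := by
    induction g₁ using FreeMor.ind
    induction f₁ using FreeMor.ind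
    induction g₂ using FreeMor.ind
    induction f₂ using FreeMor.ind
    simp only [FreeMor.comp_mk]
    simp only [FreeMor.tensor_mk, FreeMor.comp_mk]
    exact FreeMor.sound (.interchange _ _ _ _ _ _ _)
  tensor_assoc f g h := by
    induction f using FreeMor.ind
    induction g using FreeMor.ind
    induction h using FreeMor.ind
    exact FreeMor.sound (.tensor_assoc _ _ _)
  unit_tensor f := by
    induction f using FreeMor.ind
    exact FreeMor.sound (.unit_tensor _)
  tensor_unit f := by
    induction f using FreeMor.ind
    exact FreeMor.sound (.tensor_unit _)

theorem freeTensorCat_prod (D : TensorScheme.{u}) (w : List (List D.Ob)) :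
    (freeTensorCat D).prod w = w.flatten := by
  induction w with
  | nil => rfl
  | cons x w ih => exact congrArg (x ++ ·) ih

theorem flatten_singletons {α : Type u} (w : List α) : (w.map fun x => [x]).flatten = w := by
  rw [← List.flatMap_def, List.flatMap_singleton']

theorem freeTensorCat_prod_singletons (D : TensorScheme.{u}) (w : List D.Ob) :
    (freeTensorCat D).prod (w.map fun x => [x]) = w :=
  (freeTensorCat_prod D _).trans (flatten_singletons w)

/-! ## The adjunction `F ⊣ U` and the monad `T` -/

namespace FreeTerm

variable {D : TensorScheme.{u}} {V : StrictTensorCat.{u}}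

/-- The value on a word of the strict tensor functor extending `φ`. -/
def evalOb (φ : D ⟶ StrictTensorCat.U.obj V) (w : List D.Ob) : V.Ob := V.prod (w.map φ.obj)

theorem evalOb_append (φ : D ⟶ StrictTensorCat.U.obj V) (v w : List D.Ob) :
    evalOb φ (v ++ w) = V.tensorOb (evalOb φ v) (evalOb φ w) :=
  (congrArg V.prod List.map_append).trans (V.prod_append _ _)

/-- The value on a formal expression of the strict tensor functor extending `φ`. -/
def eval (φ : D ⟶ StrictTensorCat.U.obj V) :
    {a b : List D.Ob} → FreeTerm D a b → {m : V.Mor // V.s m = evalOb φ a ∧ V.t m = evalOb φ b}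
  | _, _, gen f => ⟨(φ.mor f).mor,
      (φ.mor f).s_mor.trans (congrArg V.prod (φ.s_mor f)),
      (φ.mor f).t_mor.trans (congrArg V.prod (φ.t_mor f))⟩
  | _, _, id w => ⟨V.id (evalOb φ w), V.s_id _, V.t_id _⟩
  | _, _, comp g f h =>
      ⟨V.comp (eval φ g).1 (eval φ f).1
        ((eval φ f).2.2.trans ((congrArg (evalOb φ) h).trans (eval φ g).2.1.symm)),
        (V.s_comp _ _ _).trans (eval φ f).2.1, (V.t_comp _ _ _).trans (eval φ g).2.2⟩
  | _, _, tensor f g => ⟨V.tensor (eval φ f).1 (eval φ g).1,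
      by rw [V.s_tensor, (eval φ f).2.1, (eval φ g).2.1, evalOb_append],
      by rw [V.t_tensor, (eval φ f).2.2, (eval φ g).2.2, evalOb_append]⟩

theorem eval_rel (φ : D ⟶ StrictTensorCat.U.obj V) {a b c d : List D.Ob} {f : FreeTerm D a b}
    {g : FreeTerm D c d} (h : FreeRel D f g) : (eval φ f).1 = (eval φ g).1 := by
  induction h with
  | refl f => rfl
  | symm _ ih => exact ih.symm
  | trans _ _ ih₁ ih₂ => exact ih₁.trans ih₂
  | comp_congr _ _ _ _ ih₁ ih₂ => exact V.comp_congr _ _ ih₁ ih₂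
  | tensor_congr _ _ ih₁ ih₂ => exact congrArg₂ V.tensor ih₁ ih₂
  | id_comp f h => exact V.id_comp _ _ _
  | comp_id f h => exact V.comp_id _ _ _
  | assoc => exact V.assoc _ _ _ _ _ _ _
  | tensor_id v w => exact (V.tensor_id _ _).trans (congrArg V.id (evalOb_append φ v w).symm)
  | interchange => exact V.interchange _ _ _ _ _ _ _
  | tensor_assoc => exact V.tensor_assoc _ _ _
  | unit_tensor => exact V.unit_tensor _
  | tensor_unit => exact V.tensor_unit _

end FreeTerm

/-- The strict tensor functor from the free strict tensor category extending a morphism of tensor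
schemes `D ⟶ U V`. -/
noncomputable def freeLift {D : TensorScheme.{u}} {V : StrictTensorCat.{u}}
    (φ : D ⟶ StrictTensorCat.U.obj V) : freeTensorCat D ⟶ V :=
  StrictTensorCat.Hom.mk (V := freeTensorCat D) (W := V)
    (FreeTerm.evalOb φ)
    (Quotient.lift (fun f : FreeArrow D => (FreeTerm.eval φ f.term).1)
      (fun _ _ h => FreeTerm.eval_rel φ h))
    (FreeMor.ind fun f => (FreeTerm.eval φ f).2.1)
    (FreeMor.ind fun f => (FreeTerm.eval φ f).2.2)
    (fun _ => rfl)
    (FreeMor.ind fun g => FreeMor.ind fun f h => by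
      have e : (freeTensorCat D).comp (FreeMor.mk g) (FreeMor.mk f) h = FreeMor.mk (.comp g f h) :=
        FreeMor.comp_mk g f h
      rw [e]; rfl)
    (FreeTerm.evalOb_append φ)
    rfl
    (FreeMor.ind fun _ => FreeMor.ind fun _ => rfl)

/-- The unit of the adjunction: `η` sends an object to the corresponding one-letter word and a
morphism to itself, with source and target divided into one-letter words. -/
noncomputable def freeUnit (D : TensorScheme.{u}) : D ⟶ StrictTensorCat.U.obj (freeTensorCat D) :=
  TensorScheme.Hom.mk (D := D) (E := StrictTensorCat.U.obj (freeTensorCat D))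
    (fun x => [x])
    (fun f => StrictTensorCat.Prim.mk (V := freeTensorCat D)
      ((D.s f).map fun x => [x]) ((D.t f).map fun x => [x]) (FreeMor.mk (.gen f))
      (freeTensorCat_prod_singletons D _).symm (freeTensorCat_prod_singletons D _).symm)
    (fun _ => rfl) (fun _ => rfl)

theorem freeLift_unique {D : TensorScheme.{u}} {V : StrictTensorCat.{u}}
    (K : freeTensorCat D ⟶ V) : freeLift (freeUnit D ≫ StrictTensorCat.U.map K) = K := by
  have hob : ∀ w : List D.Ob,
      FreeTerm.evalOb (freeUnit D ≫ StrictTensorCat.U.map K) w = K.obj w := by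
    intro w
    have h := StrictTensorCat.map_prod K (w.map fun x => [x])
    refine Eq.trans ?_ (h.symm.trans (congrArg K.obj (freeTensorCat_prod_singletons D w)))
    have e : ∀ v : List D.Ob, (v.map fun x => K.obj [x]) = (v.map fun x => [x]).map K.obj := by
      intro v
      induction v with
      | nil => rfl
      | cons x v ih => exact congrArg (K.obj [x] :: ·) ih
    exact congrArg V.prod (e w)
  have hmor : ∀ {a b : List D.Ob} (f : FreeTerm D a b),
      (FreeTerm.eval (freeUnit D ≫ StrictTensorCat.U.map K) f).1 = K.mor (FreeMor.mk f) := by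
    intro a b f
    induction f with
    | gen f => rfl
    | id w => exact (congrArg V.id (hob w)).trans (K.map_id w).symm
    | comp g f h ihg ihf =>
      have e : (freeTensorCat D).comp (FreeMor.mk g) (FreeMor.mk f) h = FreeMor.mk (.comp g f h) :=
        FreeMor.comp_mk g f h
      exact (V.comp_congr _ _ ihg ihf).trans
        ((K.map_comp (FreeMor.mk g) (FreeMor.mk f) h).symm.trans (congrArg K.mor e))
    | tensor f g ihf ihg =>
      exact (congrArg₂ V.tensor ihf ihg).trans (K.map_tensor (FreeMor.mk f) (FreeMor.mk g)).symm
  exact StrictTensorCat.hom_ext hob (FreeMor.ind fun f => hmor f)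

theorem freeUnit_lift {D : TensorScheme.{u}} {V : StrictTensorCat.{u}}
    (φ : D ⟶ StrictTensorCat.U.obj V) :
    freeUnit D ≫ StrictTensorCat.U.map (freeLift φ) = φ := by
  have hob : ∀ x : D.Ob, FreeTerm.evalOb φ [x] = φ.obj x := fun x => V.prod_singleton _
  have hw : ∀ w : List D.Ob,
      (w.map fun x => [x]).map (FreeTerm.evalOb φ) = w.map φ.obj := by
    intro w
    rw [List.map_map]
    exact List.map_congr_left fun x _ => hob x
  exact TensorScheme.hom_ext hob fun f => StrictTensorCat.Prim.ext
    ((hw _).trans (φ.s_mor f).symm) ((hw _).trans (φ.t_mor f).symm) rfl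

/-- The universal property of the free strict tensor category. -/
noncomputable def freeHomEquiv (D : TensorScheme.{u}) (V : StrictTensorCat.{u}) :
    (freeTensorCat D ⟶ V) ≃ (D ⟶ StrictTensorCat.U.obj V) where
  toFun K := freeUnit D ≫ StrictTensorCat.U.map K
  invFun φ := freeLift φ
  left_inv := freeLift_unique
  right_inv := freeUnit_lift

theorem freeHomEquiv_naturality (D : TensorScheme.{u}) (V W : StrictTensorCat.{u}) (K : V ⟶ W)
    (L : freeTensorCat D ⟶ V) :
    freeHomEquiv D W (L ≫ K) = freeHomEquiv D V L ≫ StrictTensorCat.U.map K := by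
  simp [freeHomEquiv]

/-- The adjunction between the free strict tensor category functor `F` and the underlying tensor
scheme functor `U`. -/
noncomputable def freeAdj :
    Adjunction.leftAdjointOfEquiv freeHomEquiv freeHomEquiv_naturality ⊣ StrictTensorCat.U.{u} :=
  Adjunction.adjunctionOfEquivLeft freeHomEquiv freeHomEquiv_naturality

/-- The monad `T = UF` on the category of tensor schemes. -/
noncomputable def tensorMonad : Monad TensorScheme.{u} := freeAdj.toMonad

/-! ## Tensor manifolds -/

/-- A tensor manifold structure on a tensor scheme `D`: an Eilenberg-Moore algebra structure over
the monad `T`. Its structure map is called the evaluation. -/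
@[ext]
structure TAlgStr (D : TensorScheme.{u}) : Type u where
  str : tensorMonad.obj D ⟶ D
  unit : tensorMonad.η.app D ≫ str = 𝟙 D
  assoc : tensorMonad.μ.app D ≫ str = tensorMonad.map str ≫ str

/-- The Eilenberg-Moore algebra given by a tensor manifold structure. -/
def TAlgStr.toAlgebra {D : TensorScheme.{u}} (A : TAlgStr D) : tensorMonad.{u}.Algebra where
  A := D
  a := A.str
  unit := A.unit
  assoc := A.assoc

/-- A morphism of tensor schemes is a morphism of `T`-algebras. -/
def IsTAlgHom {D E : TensorScheme.{u}} (A : TAlgStr D) (B : TAlgStr E) (φ : D ⟶ E) : Prop :=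
  ∃ k : A.toAlgebra ⟶ B.toAlgebra, k.f = φ

/-! ## Linear partitions

A linear partition of a word of length `n` is a division of the word into consecutive, possibly
empty, blocks. It is given by the list `I` of the lengths of its blocks, so that `I.sum = n`, and
`I.length` is the number of blocks. The tensor product of two linear partitions is `I₁ ++ I₂`,
the finest linear partition is `List.replicate n 1`, and the trivial one is `[n]`. -/

/-- For a linear partition `Q` and a linear partition `P` of the sequence of blocks of `Q`, the
coarser linear partition obtained by uniting the blocks of `Q` that lie in the same block of `P`. -/
def coarsen (P Q : List ℕ) : List ℕ := (P.splitLengths Q).map List.sum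

/-! ## Operations on a tensor scheme -/

/-- A system of operations on a tensor scheme: identity morphisms of words, a tensor product, a
composition `comp g f _ = g ∘ f` for `f` and `g` with `t f = s g`, and, for each pair `I`, `O` of
linear partitions, the fusion of `f` along `I` and `O`, for `f` such that `I` is a linear partition
of the source of `f` and `O` is a linear partition of the target of `f`. -/
@[ext]
structure Operations (D : TensorScheme.{u}) : Type u where
  ident : List D.Ob → D.Mor
  tensor : D.Mor → D.Mor → D.Mor
  comp : (g f : D.Mor) → D.t f = D.s g → D.Mor
  fusion : (I O : List ℕ) → (f : D.Mor) → I.sum = (D.s f).length → O.sum = (D.t f).length → D.Mor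

/-- The laws satisfied by the operations of a tensor manifold. Laws in which a proof of
composability, or of the fact that a list is a partition, is quantified over hold for every such
proof. -/
structure Operations.Lawful {D : TensorScheme.{u}} (P : Operations D) : Prop where
  -- sources and targets
  s_ident : ∀ w, D.s (P.ident w) = w
  t_ident : ∀ w, D.t (P.ident w) = w
  s_tensor : ∀ f g, D.s (P.tensor f g) = D.s f ++ D.s g
  t_tensor : ∀ f g, D.t (P.tensor f g) = D.t f ++ D.t g
  s_comp : ∀ g f h, D.s (P.comp g f h) = D.s f
  t_comp : ∀ g f h, D.t (P.comp g f h) = D.t g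
  length_s_fusion : ∀ I O f hI hO, (D.s (P.fusion I O f hI hO)).length = I.length
  length_t_fusion : ∀ I O f hI hO, (D.t (P.fusion I O f hI hO)).length = O.length
  -- associativity and units of the tensor product
  tensor_assoc : ∀ f g h, P.tensor (P.tensor f g) h = P.tensor f (P.tensor g h)
  unit_tensor : ∀ f, P.tensor (P.ident []) f = f
  tensor_unit : ∀ f, P.tensor f (P.ident []) = f
  -- associativity and units of the composition
  comp_assoc : ∀ k g f h₁ h₂ h₃ h₄, P.comp k (P.comp g f h₁) h₂ = P.comp (P.comp k g h₃) f h₄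
  ident_comp : ∀ f h, P.comp (P.ident (D.t f)) f h = f
  comp_ident : ∀ f h, P.comp f (P.ident (D.s f)) h = f
  -- the interchange law and the identity morphism of a word
  interchange : ∀ g₁ f₁ g₂ f₂ h₁ h₂ h, P.tensor (P.comp g₁ f₁ h₁) (P.comp g₂ f₂ h₂) =
    P.comp (P.tensor g₁ g₂) (P.tensor f₁ f₂) h
  ident_word : ∀ w, P.ident w = (w.map fun x => P.ident [x]).foldr P.tensor (P.ident [])
  -- fusions: iteration, finest partitions, tensor products, compositions and identities
  fusion_fusion : ∀ I₁ O₁ I₂ O₂ f hI₂ hO₂ hI₁ hO₁ hI hO,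
    P.fusion I₁ O₁ (P.fusion I₂ O₂ f hI₂ hO₂) hI₁ hO₁ =
      P.fusion (coarsen I₁ I₂) (coarsen O₁ O₂) f hI hO
  fusion_finest : ∀ f hI hO,
    P.fusion (List.replicate (D.s f).length 1) (List.replicate (D.t f).length 1) f hI hO = f
  fusion_tensor : ∀ I₁ O₁ I₂ O₂ f g hI₁ hO₁ hI₂ hO₂ hI hO,
    P.fusion (I₁ ++ I₂) (O₁ ++ O₂) (P.tensor f g) hI hO =
      P.tensor (P.fusion I₁ O₁ f hI₁ hO₁) (P.fusion I₂ O₂ g hI₂ hO₂)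
  fusion_comp : ∀ I J O g f h hI hO hIf hJf hJg hOg,
    ∃ h' : D.t (P.fusion I J f hIf hJf) = D.s (P.fusion J O g hJg hOg),
      P.fusion I O (P.comp g f h) hI hO = P.comp (P.fusion J O g hJg hOg) (P.fusion I J f hIf hJf) h'
  fusion_ident : ∀ I w hI hO,
    P.fusion I I (P.ident w) hI hO = P.ident (D.s (P.fusion I I (P.ident w) hI hO))

/-- A morphism of tensor schemes preserves identity morphisms, tensor products, compositions and
fusions. -/
structure PreservesOperations {D E : TensorScheme.{u}} (P : Operations D) (Q : Operations E)
    (φ : D ⟶ E) : Prop where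
  ident : ∀ w, φ.mor (P.ident w) = Q.ident (w.map φ.obj)
  tensor : ∀ f g, φ.mor (P.tensor f g) = Q.tensor (φ.mor f) (φ.mor g)
  comp : ∀ g f h, φ.mor (P.comp g f h) =
    Q.comp (φ.mor g) (φ.mor f) (by rw [φ.t_mor, φ.s_mor, h])
  fusion : ∀ I O f hI hO, φ.mor (P.fusion I O f hI hO) =
    Q.fusion I O (φ.mor f) (by rw [φ.s_mor, List.length_map, hI])
      (by rw [φ.t_mor, List.length_map, hO])

/-! ## The operations of a tensor manifold -/

/-- A prime diagram in the free strict tensor category on `D`, i.e. a morphism of `T D`: words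
`dom` and `cod` in the objects of the free strict tensor category and a morphism of it from the
concatenation of `dom` to the concatenation of `cod`. -/
noncomputable def freePrim {D : TensorScheme.{u}} (dom cod : List (List D.Ob)) (m : FreeMor D)
    (hs : m.src = dom.flatten) (ht : m.tgt = cod.flatten) : (tensorMonad.obj D).Mor :=
  StrictTensorCat.Prim.mk (V := freeTensorCat D) dom cod m
    (hs.trans (freeTensorCat_prod D dom).symm) (ht.trans (freeTensorCat_prod D cod).symm)

/-- The operations of a tensor manifold. Each of them is the evaluation of a prime diagram. For the
identity of a word, the tensor product and the composition, the diagram is the corresponding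
morphism of the free strict tensor category, with source and target divided into one-letter words;
for fusion it is the generator `f`, with source and target divided by the two partitions. -/
noncomputable def TAlgStr.ops {D : TensorScheme.{u}} (A : TAlgStr D) : Operations D where
  ident w := A.str.mor (freePrim (w.map fun x => [x]) (w.map fun x => [x]) (.mk (.id w))
    (flatten_singletons w).symm (flatten_singletons w).symm)
  tensor f g := A.str.mor (freePrim ((D.s f ++ D.s g).map fun x => [x])
    ((D.t f ++ D.t g).map fun x => [x]) (.mk (.tensor (.gen f) (.gen g)))
    (flatten_singletons _).symm (flatten_singletons _).symm)
  comp g f h := A.str.mor (freePrim ((D.s f).map fun x => [x]) ((D.t g).map fun x => [x])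
    (.mk (.comp (.gen g) (.gen f) h)) (flatten_singletons _).symm (flatten_singletons _).symm)
  fusion I O f hI hO := A.str.mor (freePrim (I.splitLengths (D.s f)) (O.splitLengths (D.t f))
    (.mk (.gen f)) (List.flatten_splitLengths (D.s f) I hI.ge).symm
    (List.flatten_splitLengths (D.t f) O hO.ge).symm)

/-! ## The monad `T` in terms of the free strict tensor category -/

/-! The prime diagrams of any strict tensor category `V` carry evident operations (`primOps`):
identities, composition and tensor product are those of `V`, and fusion keeps the morphism of `V`
while replacing each block of its source and target words by its tensor product. Their laws reduce
to the axioms of `V` and to combinatorics of lists (`primOps_lawful`), and they are the operations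
induced by the canonical algebra structure on `U V` (`algStr_ops`).

For an algebra structure on `D`, associativity says that the structure map `T D ⟶ D` is a morphism
of algebras, so it preserves operations (`TAlgStr.preservesOperations_str`); the unit law says that
`η` is a section of it. Thus `D` is a retract of `T D`, and the laws descend
(`Operations.Lawful.of_retract`).

In the other direction, `T D` is generated by `D` under the operations: a morphism of the free
category is built from generators and identities by tensor product and composition, and every prime
diagram is a fusion of one with one-letter blocks. Hence an operation-preserving map out of `T D` is
determined by its restriction along `η` (`PreservesOperations.hom_ext`). This yields uniqueness of
the algebra structure, the nontrivial half of (ii), and the associativity law needed for existence.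

For existence, a lawful system makes the words in `D` and the morphisms of `D` into a strict tensor
category (`wordCat`). The universal property of the free category gives a functor to it, and
evaluation of a prime diagram applies this functor and then fuses along the block lengths of the two
words. On objects it uses the product of a word, read off from a fused identity; the composition law
for fusion shows that every fusion has source and target given by these products (`s_fusion`,
`t_fusion`). -/

theorem tensorMonad_η_app (D : TensorScheme.{u}) : tensorMonad.η.app D = freeUnit D := by
  change freeHomEquiv D _ (𝟙 _) = _
  change freeUnit D ≫ StrictTensorCat.U.map (𝟙 _) = _
  rw [CategoryTheory.Functor.map_id]
  exact Category.comp_id (freeUnit D)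

theorem tensorMonad_map {D E : TensorScheme.{u}} (φ : D ⟶ E) :
    tensorMonad.map φ = StrictTensorCat.U.map (freeLift (φ ≫ freeUnit E)) := by
  change StrictTensorCat.U.map ((freeHomEquiv D _).symm (φ ≫ freeHomEquiv E _ (𝟙 _))) = _
  have : freeHomEquiv E _ (𝟙 _) = freeUnit E := tensorMonad_η_app E
  rw [this]
  rfl

theorem tensorMonad_μ_app (D : TensorScheme.{u}) : tensorMonad.μ.app D =
    StrictTensorCat.U.map (freeLift (𝟙 (StrictTensorCat.U.obj (freeTensorCat D)))) := by
  change StrictTensorCat.U.map (freeAdj.counit.app _) = _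
  congr 1

/-! ## The operations on prime diagrams -/

/-! ### Combinatorics of splitting a list by block lengths. -/

theorem List.splitLengths_append_append {α : Type*} (I J : List ℕ) (v w : List α)
    (h : I.sum = v.length) :
    (I ++ J).splitLengths (v ++ w) = I.splitLengths v ++ J.splitLengths w := by
  induction I generalizing v with
  | nil =>
    obtain rfl : v = [] := List.length_eq_zero_iff.1 (by simpa using h.symm)
    rfl
  | cons n I ih =>
    rw [List.sum_cons] at h
    have hn : n ≤ v.length := by omega
    rw [List.cons_append, List.splitLengths_cons, List.splitLengths_cons,
      List.take_append_of_le_length hn, List.drop_append_of_le_length hn, ih _ (by simp; omega)]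
    rfl

theorem List.splitLengths_replicate_one {α : Type*} (w : List α) :
    (List.replicate w.length 1).splitLengths w = w.map fun x => [x] := by
  induction w with
  | nil => rfl
  | cons x w ih => simp [List.replicate_succ, ih]

theorem List.splitLengths_map {α β : Type*} (g : α → β) (I : List ℕ) (w : List α) :
    I.splitLengths (w.map g) = (I.splitLengths w).map (List.map g) := by
  induction I generalizing w with
  | nil => rfl
  | cons n I ih => simp [← ih, List.map_drop]

theorem List.splitLengths_map_length_flatten {α : Type*} (L : List (List α)) :
    (L.map List.length).splitLengths L.flatten = L := by
  induction L with
  | nil => rfl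
  | cons a L ih => simp [ih]

theorem sum_coarsen (I J : List ℕ) (h : I.sum = J.length) : (coarsen I J).sum = J.sum := by
  rw [coarsen, ← List.sum_flatten, List.flatten_splitLengths _ _ h.ge]

theorem coarsen_cons (n : ℕ) (I J : List ℕ) :
    coarsen (n :: I) J = (J.take n).sum :: coarsen I (J.drop n) := by
  simp [coarsen]

theorem List.drop_splitLengths {α : Type*} (n : ℕ) (J : List ℕ) (w : List α) :
    (J.splitLengths w).drop n = (J.drop n).splitLengths (w.drop (J.take n).sum) := by
  induction n generalizing J w with
  | zero => simp
  | succ n ih => cases J with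
    | nil => simp
    | cons m J => simp [ih]

theorem List.flatten_splitLengths_eq_take {α : Type*} (J : List ℕ) (w : List α) :
    (J.splitLengths w).flatten = w.take J.sum := by
  induction J generalizing w with
  | nil => simp
  | cons m J ih => simp [ih, List.take_add]

/-- The first coarsened block takes as many letters as the first `n` blocks of `J` together, and its
letters are the concatenation of those blocks; what remains is split by `J.drop n`. This is the
combinatorial content of the law for iterated fusion. -/
theorem List.splitLengths_coarsen {α : Type*} (I J : List ℕ) (w : List α) :
    (coarsen I J).splitLengths w = (I.splitLengths (J.splitLengths w)).map List.flatten := by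
  induction I generalizing J w with
  | nil => rfl
  | cons n I ih =>
    rw [coarsen_cons, List.splitLengths_cons, List.splitLengths_cons, List.map_cons, ih,
      List.take_splitLength, List.flatten_splitLengths_eq_take, List.drop_splitLengths]

/-! ### Lawful operations on the prime diagrams of a strict tensor category. -/

namespace StrictTensorCat

variable (V : StrictTensorCat.{u})

theorem prod_flatten (L : List (List V.Ob)) : V.prod (L.map V.prod) = V.prod L.flatten := by
  induction L with
  | nil => rfl
  | cons w L ih => rw [List.map_cons, prod_cons, ih, List.flatten_cons, prod_append]

theorem map_prod_singletons (w : List V.Ob) : (w.map fun x => [x]).map V.prod = w := by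
  rw [List.map_map]
  exact (List.map_congr_left fun x _ => V.prod_singleton x).trans (List.map_id _)

theorem prod_map_splitLengths (I : List ℕ) (w : List V.Ob) (h : I.sum = w.length) :
    V.prod ((I.splitLengths w).map V.prod) = V.prod w := by
  rw [prod_flatten, List.flatten_splitLengths _ _ h.ge]

/-- The operations on the prime diagrams in a strict tensor category. -/
def primOps : Operations (U.obj V) where
  ident w := (⟨w, w, V.id (V.prod w), V.s_id _, V.t_id _⟩ : Prim V)
  tensor f g :=
    Prim.mk (V := V) (Prim.dom f ++ Prim.dom g) (Prim.cod f ++ Prim.cod g)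
      (V.tensor (Prim.mor f) (Prim.mor g))
      ((V.s_tensor _ _).trans
        ((congrArg₂ V.tensorOb (Prim.s_mor f) (Prim.s_mor g)).trans (V.prod_append _ _).symm))
      ((V.t_tensor _ _).trans
        ((congrArg₂ V.tensorOb (Prim.t_mor f) (Prim.t_mor g)).trans (V.prod_append _ _).symm))
  comp g f h :=
    Prim.mk (V := V) (Prim.dom f) (Prim.cod g)
      (V.comp (Prim.mor g) (Prim.mor f)
        ((Prim.t_mor f).trans ((congrArg V.prod h).trans (Prim.s_mor g).symm)))
      ((V.s_comp _ _ _).trans (Prim.s_mor f)) ((V.t_comp _ _ _).trans (Prim.t_mor g))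
  fusion I O f hI hO :=
    Prim.mk (V := V) ((I.splitLengths (Prim.dom f)).map V.prod)
      ((O.splitLengths (Prim.cod f)).map V.prod) (Prim.mor f)
      ((Prim.s_mor f).trans (V.prod_map_splitLengths I _ hI).symm)
      ((Prim.t_mor f).trans (V.prod_map_splitLengths O _ hO).symm)

theorem map_prod_splitLengths_coarsen (I J : List ℕ) (w : List V.Ob) :
    (I.splitLengths ((J.splitLengths w).map V.prod)).map V.prod =
      ((coarsen I J).splitLengths w).map V.prod := by
  rw [List.splitLengths_map, List.splitLengths_coarsen, List.map_map, List.map_map]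
  exact List.map_congr_left fun L _ => V.prod_flatten L

theorem map_prod_splitLengths_append (I J : List ℕ) (v w : List V.Ob) (h : I.sum = v.length) :
    ((I ++ J).splitLengths (v ++ w)).map V.prod =
      (I.splitLengths v).map V.prod ++ (J.splitLengths w).map V.prod := by
  rw [List.splitLengths_append_append _ _ _ _ h, List.map_append]

theorem map_prod_splitLengths_replicate (w : List V.Ob) :
    ((List.replicate w.length 1).splitLengths w).map V.prod = w := by
  rw [List.splitLengths_replicate_one, map_prod_singletons]

theorem primOps_lawful : V.primOps.Lawful where
  s_ident _ := rfl
  t_ident _ := rfl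
  s_tensor _ _ := rfl
  t_tensor _ _ := rfl
  s_comp _ _ _ := rfl
  t_comp _ _ _ := rfl
  length_s_fusion I O f hI hO :=
    (List.length_map V.prod).trans (List.length_splitLengths (l := Prim.dom f) (sz := I))
  length_t_fusion I O f hI hO :=
    (List.length_map V.prod).trans (List.length_splitLengths (l := Prim.cod f) (sz := O))
  tensor_assoc f g h :=
    Prim.ext (List.append_assoc _ _ _) (List.append_assoc _ _ _) (V.tensor_assoc _ _ _)
  unit_tensor f := Prim.ext rfl rfl (V.unit_tensor _)
  tensor_unit f := Prim.ext (List.append_nil _) (List.append_nil _) (V.tensor_unit _)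
  comp_assoc k g f _ _ _ _ := Prim.ext rfl rfl (V.assoc _ _ _ _ _ _ _)
  ident_comp f h := Prim.ext rfl rfl (V.id_comp _ _ _)
  comp_ident f h := Prim.ext rfl rfl (V.comp_id _ _ _)
  interchange _ _ _ _ _ _ _ := Prim.ext rfl rfl (V.interchange _ _ _ _ _ _ _)
  ident_word w := by
    induction w with
    | nil => rfl
    | cons x w ih =>
      rw [List.map_cons, List.foldr_cons, ← ih]
      exact Prim.ext rfl rfl ((congrArg V.id (V.prod_append [x] w)).trans (V.tensor_id _ _).symm)
  fusion_fusion I₁ O₁ I₂ O₂ f _ _ _ _ _ _ :=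
    Prim.ext (V.map_prod_splitLengths_coarsen _ _ _) (V.map_prod_splitLengths_coarsen _ _ _) rfl
  fusion_finest f _ _ :=
    Prim.ext (V.map_prod_splitLengths_replicate _) (V.map_prod_splitLengths_replicate _) rfl
  fusion_tensor I₁ O₁ I₂ O₂ f g hI₁ hO₁ hI₂ hO₂ hI hO :=
    Prim.ext (V.map_prod_splitLengths_append _ _ _ _ hI₁)
      (V.map_prod_splitLengths_append _ _ _ _ hO₁) rfl
  -- The middle words agree before fusion and are divided by the same `J`, so they agree afterwards;
  -- the underlying composite in `V` is untouched.
  fusion_comp I J O g f h hI hO hIf hJf hJg hOg :=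
    ⟨congrArg (fun w => (J.splitLengths w).map V.prod) h, rfl⟩
  fusion_ident I w hI hO :=
    Prim.ext rfl rfl (congrArg V.id (V.prod_map_splitLengths I w hI).symm)

end StrictTensorCat

/-! ## Functoriality of the free strict tensor category -/

/-- The strict tensor functor between free strict tensor categories induced by a morphism of tensor
schemes. -/
noncomputable def freeMap {D E : TensorScheme.{u}} (φ : D ⟶ E) :
    freeTensorCat D ⟶ freeTensorCat E :=
  freeLift (φ ≫ freeUnit E)

theorem freeMap_obj {D E : TensorScheme.{u}} (φ : D ⟶ E) (w : List D.Ob) :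
    (freeMap φ).obj w = w.map φ.obj := by
  have h : (w.map φ.obj).map (fun x => [x]) = w.map (φ ≫ freeUnit E).obj := List.map_map
  exact (congrArg (freeTensorCat E).prod h.symm).trans (freeTensorCat_prod_singletons E _)

theorem map_freeMap_obj {D E : TensorScheme.{u}} (φ : D ⟶ E) (L : List (List D.Ob)) :
    L.map (freeMap φ).obj = L.map (List.map φ.obj) :=
  List.map_congr_left fun w _ => freeMap_obj φ w

theorem map_freeMap_obj_singletons {D E : TensorScheme.{u}} (φ : D ⟶ E) (w : List D.Ob) :
    (w.map fun x => [x]).map (freeMap φ).obj = (w.map φ.obj).map fun x => [x] := by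
  rw [map_freeMap_obj, List.map_map, List.map_map]
  rfl

/-! ## Morphisms of algebras preserve the operations -/

theorem isTAlgHom_iff {D E : TensorScheme.{u}} (A : TAlgStr D) (B : TAlgStr E) (φ : D ⟶ E) :
    IsTAlgHom A B φ ↔ tensorMonad.map φ ≫ B.str = A.str ≫ φ :=
  ⟨fun ⟨k, hk⟩ => hk ▸ k.h, fun h => ⟨⟨φ, h⟩, rfl⟩⟩

theorem Operations.comp_congr {D : TensorScheme.{u}} (P : Operations D) {g g' f f' : D.Mor}
    (h : D.t f = D.s g) (h' : D.t f' = D.s g') (hg : g = g') (hf : f = f') :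
    P.comp g f h = P.comp g' f' h' := by
  subst hg hf; rfl

theorem Operations.fusion_congr {D : TensorScheme.{u}} (P : Operations D) {I I' O O' : List ℕ}
    {f f' : D.Mor} (hI : I.sum = (D.s f).length) (hO : O.sum = (D.t f).length)
    (hI' : I'.sum = (D.s f').length) (hO' : O'.sum = (D.t f').length)
    (eI : I = I') (eO : O = O') (hf : f = f') :
    P.fusion I O f hI hO = P.fusion I' O' f' hI' hO' := by
  subst eI eO hf; rfl

theorem FreeMor.mk_comp {D : TensorScheme.{u}} {a b b' c : List D.Ob} (g : FreeTerm D b' c)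
    (f : FreeTerm D a b) (h : b = b') :
    FreeMor.mk (.comp g f h) = (freeTensorCat D).comp (FreeMor.mk g) (FreeMor.mk f) h :=
  (FreeMor.comp_mk g f h).symm

theorem freeMap_mor_comp_gen {D E : TensorScheme.{u}} (φ : D ⟶ E) (g f : D.Mor)
    (h : D.t f = D.s g) (h' : E.t (φ.mor f) = E.s (φ.mor g)) :
    (freeMap φ).mor (.mk (.comp (.gen g) (.gen f) h)) =
      .mk (.comp (.gen (φ.mor g)) (.gen (φ.mor f)) h') := by
  rw [FreeMor.mk_comp, FreeMor.mk_comp]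
  exact (freeMap φ).map_comp (.mk (.gen g)) (.mk (.gen f)) h

theorem PreservesOperations.of_isTAlgHom {D E : TensorScheme.{u}} {A : TAlgStr D} {B : TAlgStr E}
    {φ : D ⟶ E} (hφ : IsTAlgHom A B φ) : PreservesOperations A.ops B.ops φ := by
  rw [isTAlgHom_iff, tensorMonad_map] at hφ
  -- By the algebra square, it suffices that `freeMap φ` carries each defining diagram of an
  -- operation on `D` to the corresponding diagram for `E`.
  have key : ∀ (p : StrictTensorCat.Prim (freeTensorCat D)) (q : (tensorMonad.obj E).Mor),
      (StrictTensorCat.U.map (freeMap φ)).mor p = q → φ.mor (A.str.mor p) = B.str.mor q := by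
    rintro p q rfl
    exact (congrFun (congrArg TensorScheme.Hom.mor hφ) p).symm
  have sing : ∀ {v : List D.Ob} {w : List E.Ob}, w = v.map φ.obj →
      (v.map fun x => [x]).map (freeMap φ).obj = w.map fun x => [x] := by
    rintro v w rfl
    exact map_freeMap_obj_singletons φ v
  have split : ∀ (I : List ℕ) {v : List D.Ob} {w : List E.Ob}, w = v.map φ.obj →
      (I.splitLengths v).map (freeMap φ).obj = I.splitLengths w := by
    rintro I v w rfl
    rw [map_freeMap_obj, List.splitLengths_map]
  constructor
  · intro w
    refine key _ _ (StrictTensorCat.Prim.ext (sing rfl) (sing rfl) ?_)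
    exact ((freeMap φ).map_id w).trans (congrArg (freeTensorCat E).id (freeMap_obj φ w))
  · intro f g
    refine key _ _ (StrictTensorCat.Prim.ext (sing ?_) (sing ?_) ?_)
    · rw [φ.s_mor, φ.s_mor, List.map_append]
    · rw [φ.t_mor, φ.t_mor, List.map_append]
    · exact (freeMap φ).map_tensor (.mk (.gen f)) (.mk (.gen g))
  · intro g f h
    exact key _ _ (StrictTensorCat.Prim.ext (sing (φ.s_mor f)) (sing (φ.t_mor g))
      (freeMap_mor_comp_gen φ g f h _))
  · intro I O f hI hO
    exact key _ _ (StrictTensorCat.Prim.ext (split I (φ.s_mor f)) (split O (φ.t_mor f)) rfl)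

/-! ## The tensor manifold of prime diagrams -/

/-- The tensor manifold structure on the underlying tensor scheme of a strict tensor category. -/
noncomputable def StrictTensorCat.algStr (V : StrictTensorCat.{u}) : TAlgStr (U.obj V) where
  str := U.map (freeLift (𝟙 (U.obj V)))
  unit := by
    rw [tensorMonad_η_app]
    exact freeUnit_lift _
  -- The structure map is the image under `U` of the counit at `V`, so this is the algebra supplied
  -- by the comparison functor.
  assoc := (((Monad.comparison freeAdj).obj V).assoc :)

theorem StrictTensorCat.algStr_ops (V : StrictTensorCat.{u}) : V.algStr.ops = V.primOps := by
  have hob : ∀ w, (freeLift (𝟙 (U.obj V))).obj w = V.prod w := fun w =>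
    congrArg V.prod (List.map_id w)
  have sing : ∀ w : List V.Ob, (w.map fun x => [x]).map (freeLift (𝟙 (U.obj V))).obj = w :=
    fun w => (List.map_congr_left fun x _ => hob x).trans (V.map_prod_singletons w)
  have split : ∀ (I : List ℕ) (w : List V.Ob),
      (I.splitLengths w).map (freeLift (𝟙 (U.obj V))).obj = (I.splitLengths w).map V.prod :=
    fun I w => List.map_congr_left fun x _ => hob x
  apply Operations.ext
  · funext w
    exact Prim.ext (sing w) (sing w) (congrArg V.id (hob w))
  · funext f g
    exact Prim.ext (sing _) (sing _) rfl
  · funext g f h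
    exact Prim.ext (sing _) (sing _) rfl
  · funext I O f hI hO
    exact Prim.ext (split I _) (split O _) rfl

/-- Associativity exhibits `A.str` as an algebra morphism from the free algebra, since `μ` is the
structure map of the canonical algebra on `U (F D)`. -/
theorem TAlgStr.preservesOperations_str {D : TensorScheme.{u}} (A : TAlgStr D) :
    PreservesOperations (freeTensorCat D).primOps A.ops A.str := by
  rw [← StrictTensorCat.algStr_ops]
  apply PreservesOperations.of_isTAlgHom
  apply (isTAlgHom_iff (freeTensorCat D).algStr A A.str).2
  exact A.assoc.symm.trans (congrArg (· ≫ A.str) (tensorMonad_μ_app D))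

/-! ## Lawfulness of the induced operations -/

/-- Each operation on `D` is computed by lifting the arguments along `η`, operating in `E` and
projecting by `χ`. The section `η` is not assumed to preserve operations, and the unit of the monad
indeed does not send identities to identities. -/
theorem Operations.Lawful.of_retract {D E : TensorScheme.{u}} {P : Operations E} {Q : Operations D}
    (hP : P.Lawful) (η : D ⟶ E) (χ : E ⟶ D) (h : η ≫ χ = 𝟙 D) (hχ : PreservesOperations P Q χ) :
    Q.Lawful := by
  have hm : ∀ f, χ.mor (η.mor f) = f := fun f => congrFun (congrArg TensorScheme.Hom.mor h) f
  have ho : ∀ x, χ.obj (η.obj x) = x := fun x => congrFun (congrArg TensorScheme.Hom.obj h) x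
  have hw : ∀ w : List D.Ob, (w.map η.obj).map χ.obj = w := fun w => by
    rw [List.map_map]
    exact (List.map_congr_left fun x _ => ho x).trans (List.map_id _)
  have hη : ∀ {f g : D.Mor}, D.t f = D.s g → E.t (η.mor f) = E.s (η.mor g) := fun h => by
    rw [η.t_mor, η.s_mor, h]
  have hident : ∀ w, Q.ident w = χ.mor (P.ident (w.map η.obj)) := fun w => by
    rw [hχ.ident, hw]
  have hident' : ∀ w, Q.ident (w.map χ.obj) = χ.mor (P.ident w) := fun w => (hχ.ident w).symm
  have htensor : ∀ f g, Q.tensor f g = χ.mor (P.tensor (η.mor f) (η.mor g)) := fun f g => by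
    rw [hχ.tensor, hm, hm]
  -- Any composable lifts may be used, but their composability is a separate hypothesis: objects
  -- identified by `χ` may differ in `E`.
  have hcomp : ∀ {g f : D.Mor} (h : D.t f = D.s g) {g' f' : E.Mor} (h' : E.t f' = E.s g'),
      g = χ.mor g' → f = χ.mor f' → Q.comp g f h = χ.mor (P.comp g' f' h') := by
    rintro _ _ h g' f' h' rfl rfl
    exact (hχ.comp _ _ _).symm
  have hI' : ∀ {I : List ℕ} {f : D.Mor}, I.sum = (D.s f).length →
      I.sum = (E.s (η.mor f)).length := fun h => by rw [η.s_mor, List.length_map, h]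
  have hO' : ∀ {I : List ℕ} {f : D.Mor}, I.sum = (D.t f).length →
      I.sum = (E.t (η.mor f)).length := fun h => by rw [η.t_mor, List.length_map, h]
  have hs : ∀ {I : List ℕ} {f' : E.Mor}, I.sum = (D.s (χ.mor f')).length →
      I.sum = (E.s f').length := fun h => by rw [h, χ.s_mor, List.length_map]
  have ht : ∀ {I : List ℕ} {f' : E.Mor}, I.sum = (D.t (χ.mor f')).length →
      I.sum = (E.t f').length := fun h => by rw [h, χ.t_mor, List.length_map]
  have hfusion : ∀ {I O : List ℕ} {f : D.Mor} (hI : I.sum = (D.s f).length)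
      (hO : O.sum = (D.t f).length) {f' : E.Mor} (hI' : I.sum = (E.s f').length)
      (hO' : O.sum = (E.t f').length),
      f = χ.mor f' → Q.fusion I O f hI hO = χ.mor (P.fusion I O f' hI' hO') := by
    rintro I O _ hI hO f' hI' hO' rfl
    exact (hχ.fusion _ _ _ _ _).symm
  constructor
  · intro w
    rw [hident, χ.s_mor, hP.s_ident, hw]
  · intro w
    rw [hident, χ.t_mor, hP.t_ident, hw]
  · intro f g
    rw [htensor, χ.s_mor, hP.s_tensor, List.map_append, ← χ.s_mor, ← χ.s_mor, hm, hm]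
  · intro f g
    rw [htensor, χ.t_mor, hP.t_tensor, List.map_append, ← χ.t_mor, ← χ.t_mor, hm, hm]
  · intro g f h
    rw [hcomp h (hη h) (hm g).symm (hm f).symm, χ.s_mor, hP.s_comp, ← χ.s_mor, hm]
  · intro g f h
    rw [hcomp h (hη h) (hm g).symm (hm f).symm, χ.t_mor, hP.t_comp, ← χ.t_mor, hm]
  · intro I O f hI hO
    rw [hfusion hI hO (hI' hI) (hO' hO) (hm f).symm, χ.s_mor, List.length_map,
      hP.length_s_fusion]
  · intro I O f hI hO
    rw [hfusion hI hO (hI' hI) (hO' hO) (hm f).symm, χ.t_mor, List.length_map,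
      hP.length_t_fusion]
  · intro f g h
    rw [← hm f, ← hm g, ← hm h]
    simp only [← hχ.tensor]
    rw [hP.tensor_assoc]
  · intro f
    rw [← hm f, hident, ← hχ.tensor, List.map_nil, hP.unit_tensor]
  · intro f
    rw [← hm f, hident, ← hχ.tensor, List.map_nil, hP.tensor_unit]
  · intro k g f h₁ h₂ h₃ h₄
    have e₁ := hη h₁
    have e₃ := hη h₃
    have e₂ : E.t (P.comp (η.mor g) (η.mor f) e₁) = E.s (η.mor k) := by rw [hP.t_comp, e₃]
    have e₄ : E.t (η.mor f) = E.s (P.comp (η.mor k) (η.mor g) e₃) := by rw [hP.s_comp, e₁]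
    rw [hcomp h₂ e₂ (hm k).symm (hcomp h₁ e₁ (hm g).symm (hm f).symm),
      hcomp h₄ e₄ (hcomp h₃ e₃ (hm k).symm (hm g).symm) (hm f).symm,
      hP.comp_assoc _ _ _ e₁ e₂ e₃ e₄]
  · intro f h
    -- The identity is lifted to the identity of the target of `η.mor f`, not to its own image under
    -- `η`, so that the unit law of `E` applies.
    rw [hcomp h (hP.s_ident _).symm (f' := η.mor f) ?_ (hm f).symm, hP.ident_comp, hm]
    rw [← hident', ← χ.t_mor, hm]
  · intro f h
    rw [hcomp h (hP.t_ident _) (g' := η.mor f) (hm f).symm ?_, hP.comp_ident, hm]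
    rw [← hident', ← χ.s_mor, hm]
  · intro g₁ f₁ g₂ f₂ h₁ h₂ h
    have e₁ := hη h₁
    have e₂ := hη h₂
    have e : E.t (P.tensor (η.mor f₁) (η.mor f₂)) = E.s (P.tensor (η.mor g₁) (η.mor g₂)) := by
      rw [hP.t_tensor, hP.s_tensor, e₁, e₂]
    rw [hcomp h₁ e₁ (hm g₁).symm (hm f₁).symm, hcomp h₂ e₂ (hm g₂).symm (hm f₂).symm,
      hcomp h e (htensor _ _) (htensor _ _), ← hχ.tensor, hP.interchange _ _ _ _ _ _ e]
  · intro w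
    induction w with
    | nil => rfl
    | cons x w ih =>
      rw [List.map_cons, List.foldr_cons, ← ih]
      simp only [hident]
      rw [← hχ.tensor]
      congr 1
      -- With both identities expanded into one-letter factors, the two sides are the same right
      -- fold.
      rw [hP.ident_word (List.map η.obj w), hP.ident_word (List.map η.obj (x :: w))]
      rfl
  · intro I₁ O₁ I₂ O₂ f hI₂ hO₂ hI₁ hO₁ hI hO
    -- The inner fusion is lifted to a fusion in `E`; since `χ` preserves lengths of words, the
    -- outer partitions fit this lift as well.
    have e := hfusion hI₂ hO₂ (hI' hI₂) (hO' hO₂) (hm f).symm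
    have e₁ := hs (e ▸ hI₁)
    have e₂ := ht (e ▸ hO₁)
    rw [hfusion hI₁ hO₁ e₁ e₂ e, hfusion hI hO (hI' hI) (hO' hO) (hm f).symm,
      hP.fusion_fusion _ _ _ _ _ _ _ _ _ (hI' hI) (hO' hO)]
  · intro f hI hO
    have e := hP.fusion_finest (η.mor f) (by simp) (by simp)
    rw [hfusion hI hO (hI' hI) (hO' hO) (hm f).symm]
    refine Eq.trans (congrArg χ.mor ?_) (hm f)
    refine Eq.trans ?_ e
    apply P.fusion_congr
    · rw [η.s_mor, List.length_map]
    · rw [η.t_mor, List.length_map]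
    · rfl
  · intro I₁ O₁ I₂ O₂ f g hI₁ hO₁ hI₂ hO₂ hI hO
    have e := htensor f g
    rw [hfusion hI₁ hO₁ (hI' hI₁) (hO' hO₁) (hm f).symm,
      hfusion hI₂ hO₂ (hI' hI₂) (hO' hO₂) (hm g).symm, ← hχ.tensor,
      hfusion hI hO (hs (e ▸ hI)) (ht (e ▸ hO)) e,
      hP.fusion_tensor _ _ _ _ _ _ (hI' hI₁) (hO' hO₁) (hI' hI₂) (hO' hO₂)]
  · intro I J O g f h hI hO hIf hJf hJg hOg
    have e := hcomp h (hη h) (hm g).symm (hm f).symm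
    obtain ⟨k, hk⟩ := hP.fusion_comp I J O _ _ (hη h) (hs (e ▸ hI)) (ht (e ▸ hO)) (hI' hIf)
      (hO' hJf) (hI' hJg) (hO' hOg)
    have e₁ := hfusion hIf hJf (hI' hIf) (hO' hJf) (hm f).symm
    have e₂ := hfusion hJg hOg (hI' hJg) (hO' hOg) (hm g).symm
    have k' : D.t (Q.fusion I J f hIf hJf) = D.s (Q.fusion J O g hJg hOg) := by
      rw [e₁, e₂, χ.t_mor, χ.s_mor, k]
    exact ⟨k', by rw [hcomp k' k e₂ e₁, ← hk, hfusion hI hO _ _ e]⟩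
  · intro I w hI hO
    have e := hident w
    rw [hfusion hI hO (hs (e ▸ hI)) (ht (e ▸ hO)) e, χ.s_mor, hident', ← hP.fusion_ident]

theorem TAlgStr.lawful_ops {D : TensorScheme.{u}} (A : TAlgStr D) : A.ops.Lawful :=
  (freeTensorCat D).primOps_lawful.of_retract (tensorMonad.η.app D) A.str A.unit
    A.preservesOperations_str

/-! ## Morphisms that preserve the operations -/

theorem PreservesOperations.trans {D E G : TensorScheme.{u}} {P : Operations D} {Q : Operations E}
    {R : Operations G} {φ : D ⟶ E} {ψ : E ⟶ G} (hφ : PreservesOperations P Q φ)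
    (hψ : PreservesOperations Q R ψ) : PreservesOperations P R (φ ≫ ψ) where
  ident w := by
    change ψ.mor (φ.mor _) = R.ident (w.map fun x => ψ.obj (φ.obj x))
    rw [hφ.ident, hψ.ident, List.map_map]
    rfl
  tensor f g := by
    change ψ.mor (φ.mor _) = R.tensor (ψ.mor (φ.mor _)) (ψ.mor (φ.mor _))
    rw [hφ.tensor, hψ.tensor]
  comp g f h := by
    change ψ.mor (φ.mor _) = R.comp (ψ.mor (φ.mor _)) (ψ.mor (φ.mor _)) _
    rw [hφ.comp, hψ.comp]
  fusion I O f hI hO := by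
    change ψ.mor (φ.mor _) = R.fusion I O (ψ.mor (φ.mor _)) _ _
    rw [hφ.fusion, hψ.fusion]

/-- A strict tensor functor commutes with tensor products of words, which is all that fusion adds to
the structure it preserves by definition. -/
theorem StrictTensorCat.preservesOperations_map {V W : StrictTensorCat.{u}} (K : V ⟶ W) :
    PreservesOperations V.primOps W.primOps (U.map K) := by
  have split : ∀ (I : List ℕ) (w : List V.Ob), ((I.splitLengths w).map V.prod).map K.obj =
      (I.splitLengths (w.map K.obj)).map W.prod := fun I w => by
    rw [List.splitLengths_map, List.map_map, List.map_map]
    exact List.map_congr_left fun v _ => map_prod K v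
  constructor
  · intro w
    exact Prim.ext rfl rfl ((K.map_id _).trans (congrArg W.id (map_prod K w)))
  · intro f g
    exact Prim.ext List.map_append List.map_append (K.map_tensor _ _)
  · intro g f h
    exact Prim.ext rfl rfl (K.map_comp _ _ _)
  · intro I O f hI hO
    exact Prim.ext (split I _) (split O _) rfl

/-- A morphism of the free strict tensor category, with source and target divided into one-letter
words. -/
noncomputable def singletonPrim {D : TensorScheme.{u}} {a b : List D.Ob} (f : FreeTerm D a b) :
    StrictTensorCat.Prim (freeTensorCat D) where
  dom := a.map fun x => [x]
  cod := b.map fun x => [x]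
  mor := FreeMor.mk f
  s_mor := (freeTensorCat_prod_singletons D a).symm
  t_mor := (freeTensorCat_prod_singletons D b).symm

theorem singletonPrim_comp {D : TensorScheme.{u}} {a b b' c : List D.Ob} (g : FreeTerm D b' c)
    (f : FreeTerm D a b) (h : b = b') : singletonPrim (.comp g f h) =
      (freeTensorCat D).primOps.comp (singletonPrim g) (singletonPrim f)
        (congrArg (List.map fun x => [x]) h) :=
  StrictTensorCat.Prim.ext rfl rfl (FreeMor.mk_comp g f h)

theorem singletonPrim_tensor {D : TensorScheme.{u}} {a b c d : List D.Ob} (f : FreeTerm D a b)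
    (g : FreeTerm D c d) : singletonPrim (.tensor f g) =
      (freeTensorCat D).primOps.tensor (singletonPrim f) (singletonPrim g) :=
  StrictTensorCat.Prim.ext List.map_append List.map_append rfl

theorem singletonPrim_id {D : TensorScheme.{u}} (w : List D.Ob) : singletonPrim (.id w) =
      (freeTensorCat D).primOps.ident (w.map fun x => [x]) :=
  StrictTensorCat.Prim.ext rfl rfl
    (congrArg (freeTensorCat D).id (freeTensorCat_prod_singletons D w).symm)

theorem splitLengths_map_length_singletons {D : TensorScheme.{u}} (L : List (List D.Ob)) :
    ((L.map List.length).splitLengths ((freeTensorCat D).prod L |>.map fun x => [x])).map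
      (freeTensorCat D).prod = L := by
  rw [freeTensorCat_prod, List.splitLengths_map, List.splitLengths_map_length_flatten]
  exact List.map_map.trans ((List.map_congr_left fun w _ =>
    freeTensorCat_prod_singletons D w).trans (List.map_id _))

theorem sum_map_length_eq {D : TensorScheme.{u}} (L : List (List D.Ob)) {a : List D.Ob}
    (h : a = (freeTensorCat D).prod L) : (L.map List.length).sum = a.length := by
  rw [h, freeTensorCat_prod, List.length_flatten]

/-- Every prime diagram in the free strict tensor category is a fusion of a prime diagram whose
source and target are divided into one-letter words. -/
theorem eq_fusion_singletonPrim {D : TensorScheme.{u}}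
    (p : StrictTensorCat.Prim (freeTensorCat D)) :
    ∃ (I O : List ℕ) (a b : List D.Ob) (f : FreeTerm D a b)
      (hI : I.sum = (a.map fun x => [x]).length) (hO : O.sum = (b.map fun x => [x]).length),
      p = (freeTensorCat D).primOps.fusion I O (singletonPrim f) hI hO := by
  obtain ⟨v, w, m, hs, ht⟩ := p
  induction m using FreeMor.ind with
  | h f =>
    rename_i a b
    replace hs : a = (freeTensorCat D).prod v := hs
    replace ht : b = (freeTensorCat D).prod w := ht
    -- The partitions record the lengths of the given words: regrouping the single letters
    -- accordingly and multiplying within each block restores these words.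
    refine ⟨v.map List.length, w.map List.length, a, b, f, ?_, ?_,
      StrictTensorCat.Prim.ext ?_ ?_ rfl⟩
    · rw [List.length_map, sum_map_length_eq v hs]
    · rw [List.length_map, sum_map_length_eq w ht]
    · subst hs
      exact (splitLengths_map_length_singletons v).symm
    · subst ht
      exact (splitLengths_map_length_singletons w).symm

/-- `T D` is generated by the image of `freeUnit D`: induction on formal expressions handles
diagrams with one-letter blocks, and one fusion reaches all others. No laws are required of `Q`. -/
theorem PreservesOperations.hom_ext {D E : TensorScheme.{u}} {Q : Operations E}
    {χ ψ : StrictTensorCat.U.obj (freeTensorCat D) ⟶ E}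
    (hχ : PreservesOperations (freeTensorCat D).primOps Q χ)
    (hψ : PreservesOperations (freeTensorCat D).primOps Q ψ)
    (h : freeUnit D ≫ χ = freeUnit D ≫ ψ) : χ = ψ := by
  have hob : ∀ x : D.Ob, χ.obj [x] = ψ.obj [x] := fun x =>
    congrFun (congrArg TensorScheme.Hom.obj h) x
  have hsing : ∀ {a b : List D.Ob} (f : FreeTerm D a b),
      χ.mor (singletonPrim f) = ψ.mor (singletonPrim f) := by
    intro a b f
    induction f with
    | gen f => exact congrFun (congrArg TensorScheme.Hom.mor h) f
    | id w =>
      rw [singletonPrim_id, hχ.ident, hψ.ident]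
      exact congrArg Q.ident (List.map_map.trans ((List.map_congr_left fun x _ => hob x).trans
        List.map_map.symm))
    | comp g f h ihg ihf =>
      rw [singletonPrim_comp]
      exact (hχ.comp _ _ _).trans ((Q.comp_congr _ _ ihg ihf).trans (hψ.comp _ _ _).symm)
    | tensor f g ihf ihg =>
      rw [singletonPrim_tensor]
      exact (hχ.tensor _ _).trans ((congrArg₂ Q.tensor ihf ihg).trans (hψ.tensor _ _).symm)
  have hmor : ∀ p, χ.mor p = ψ.mor p := by
    intro p
    obtain ⟨I, O, a, b, f, hI, hO, rfl⟩ := eq_fusion_singletonPrim p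
    exact (hχ.fusion _ _ _ _ _).trans
      ((Q.fusion_congr _ _ _ _ rfl rfl (hsing f)).trans (hψ.fusion _ _ _ _ _).symm)
  refine TensorScheme.hom_ext (fun w => ?_) hmor
  -- Agreement on objects, so far known only for one-letter words, follows for any `w` by comparing
  -- sources of the identity of the word whose only letter is `w`.
  have e := congrArg E.s (hmor ((freeTensorCat D).primOps.ident [w]))
  rw [χ.s_mor, ψ.s_mor] at e
  exact List.singleton_injective e

/-- Since every argument in `D` lifts along `η`, operations preserved by the retraction are forced
by those of `E`. -/
theorem Operations.eq_of_retract {D E : TensorScheme.{u}} {P : Operations E} {Q R : Operations D}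
    (η : D ⟶ E) (χ : E ⟶ D) (h : η ≫ χ = 𝟙 D) (hQ : PreservesOperations P Q χ)
    (hR : PreservesOperations P R χ) : Q = R := by
  have hm : ∀ f, χ.mor (η.mor f) = f := fun f => congrFun (congrArg TensorScheme.Hom.mor h) f
  have ho : ∀ x, χ.obj (η.obj x) = x := fun x => congrFun (congrArg TensorScheme.Hom.obj h) x
  apply Operations.ext
  · funext w
    have e := (hQ.ident (w.map η.obj)).symm.trans (hR.ident _)
    have hw : (w.map η.obj).map χ.obj = w :=
      List.map_map.trans ((List.map_congr_left fun x _ => ho x).trans (List.map_id _))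
    rwa [hw] at e
  · funext f g
    have e := (hQ.tensor (η.mor f) (η.mor g)).symm.trans (hR.tensor _ _)
    rwa [hm, hm] at e
  · funext g f h
    have e := (hQ.comp (η.mor g) (η.mor f) (by rw [η.t_mor, η.s_mor, h])).symm.trans (hR.comp _ _ _)
    exact (Q.comp_congr _ _ (hm g).symm (hm f).symm).trans
      (e.trans (R.comp_congr _ _ (hm g) (hm f)))
  · funext I O f hI hO
    have e := (hQ.fusion I O (η.mor f) (by rw [η.s_mor, List.length_map, hI])
      (by rw [η.t_mor, List.length_map, hO])).symm.trans (hR.fusion _ _ _ _ _)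
    exact (Q.fusion_congr _ _ _ _ rfl rfl (hm f).symm).trans
      (e.trans (R.fusion_congr _ _ _ _ rfl rfl (hm f)))

theorem freeUnit_comp_map {D E : TensorScheme.{u}} (φ : D ⟶ E) :
    freeUnit D ≫ tensorMonad.map φ = φ ≫ freeUnit E := by
  rw [tensorMonad_map]
  exact freeUnit_lift _

theorem TAlgStr.freeUnit_comp_str {D : TensorScheme.{u}} (A : TAlgStr D) :
    freeUnit D ≫ A.str = 𝟙 D :=
  (congrArg (· ≫ A.str) (tensorMonad_η_app D).symm).trans A.unit

theorem preservesOperations_tensorMonad_map {D E : TensorScheme.{u}} (φ : D ⟶ E) :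
    PreservesOperations (freeTensorCat D).primOps (freeTensorCat E).primOps
      (tensorMonad.map φ) := by
  rw [tensorMonad_map]
  exact StrictTensorCat.preservesOperations_map _

/-- Both sides of the algebra square are operation-preserving maps out of `T D`, and both restrict
to `φ` along the unit. -/
theorem PreservesOperations.isTAlgHom {D E : TensorScheme.{u}} {A : TAlgStr D} {B : TAlgStr E}
    {φ : D ⟶ E} (hφ : PreservesOperations A.ops B.ops φ) : IsTAlgHom A B φ := by
  rw [isTAlgHom_iff]
  refine PreservesOperations.hom_ext
    ((preservesOperations_tensorMonad_map φ).trans B.preservesOperations_str)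
    (A.preservesOperations_str.trans hφ) ?_
  calc freeUnit D ≫ tensorMonad.map φ ≫ B.str
      = (freeUnit D ≫ tensorMonad.map φ) ≫ B.str := (Category.assoc _ _ _).symm
    _ = (φ ≫ freeUnit E) ≫ B.str := congrArg (· ≫ B.str) (freeUnit_comp_map φ)
    _ = φ ≫ freeUnit E ≫ B.str := Category.assoc _ _ _
    _ = φ ≫ 𝟙 E := congrArg (φ ≫ ·) B.freeUnit_comp_str
    _ = 𝟙 D ≫ φ := by rw [Category.comp_id, Category.id_comp]
    _ = (freeUnit D ≫ A.str) ≫ φ := congrArg (· ≫ φ) A.freeUnit_comp_str.symm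
    _ = freeUnit D ≫ A.str ≫ φ := Category.assoc _ _ _

/-- If two structures induce the same operations, both structure maps preserve them and split the
same unit, so `hom_ext` identifies them. -/
theorem TAlgStr.ops_injective {D : TensorScheme.{u}} :
    Function.Injective (TAlgStr.ops (D := D)) := by
  intro A B h
  have hB := B.preservesOperations_str
  rw [← h] at hB
  exact TAlgStr.ext (A.preservesOperations_str.hom_ext hB
    (A.freeUnit_comp_str.trans B.freeUnit_comp_str.symm))

/-! ## The tensor manifold given by a lawful system of operations -/

namespace Operations.Lawful

variable {D : TensorScheme.{u}} {P : Operations D}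

/-! ### Sources and targets of fusions. -/

theorem ident_cons (hP : P.Lawful) (x : D.Ob) (w : List D.Ob) :
    P.ident (x :: w) = P.tensor (P.ident [x]) (P.ident w) := by
  rw [hP.ident_word (x :: w), hP.ident_word w]
  rfl

theorem ident_append (hP : P.Lawful) (v w : List D.Ob) :
    P.tensor (P.ident v) (P.ident w) = P.ident (v ++ w) := by
  induction v with
  | nil => exact hP.unit_tensor _
  | cons x v ih =>
    rw [List.cons_append, hP.ident_cons x (v ++ w), ← ih, hP.ident_cons, hP.tensor_assoc]

/-- A single block leaves a single letter. The letter is chosen before the partition proofs are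
quantified, so the product of a word does not depend on them. -/
theorem exists_s_fusion_ident (hP : P.Lawful) (w : List D.Ob) :
    ∃ x, ∀ hI hO, D.s (P.fusion [w.length] [w.length] (P.ident w) hI hO) = [x] := by
  have hI : [w.length].sum = (D.s (P.ident w)).length := by rw [hP.s_ident, List.sum_singleton]
  have hO : [w.length].sum = (D.t (P.ident w)).length := by rw [hP.t_ident, List.sum_singleton]
  obtain ⟨x, hx⟩ := List.length_eq_one_iff.1 (hP.length_s_fusion _ _ _ hI hO)
  exact ⟨x, fun _ _ => hx⟩

/-- The product of a word of objects: the source of the identity morphism of the word, fused along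
the trivial linear partition. -/
noncomputable def prodOb (hP : P.Lawful) (w : List D.Ob) : D.Ob :=
  (hP.exists_s_fusion_ident w).choose

/-- Induction on the blocks: the identity of a concatenation is a tensor product of identities, and
fusion respects tensor products, so the first block splits off and contributes its product. -/
theorem s_fusion_ident (hP : P.Lawful) (I : List ℕ) (w : List D.Ob) (hI hO) :
    D.s (P.fusion I I (P.ident w) hI hO) = (I.splitLengths w).map hP.prodOb := by
  induction I generalizing w with
  | nil => exact List.length_eq_zero_iff.1 (hP.length_s_fusion _ _ _ _ _)
  | cons n I ih =>
    have h : n + I.sum = w.length := by rwa [hP.s_ident, List.sum_cons] at hI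
    obtain ⟨v, w, rfl, rfl⟩ : ∃ v w', w = v ++ w' ∧ n = v.length :=
      ⟨w.take n, w.drop n, (List.take_append_drop n w).symm, by rw [List.length_take]; omega⟩
    have hv : [v.length].sum = v.length := List.sum_singleton
    have hw : I.sum = w.length := by rw [List.length_append] at h; omega
    have hIv : [v.length].sum = (D.s (P.ident v)).length := by rw [hP.s_ident, hv]
    have hOv : [v.length].sum = (D.t (P.ident v)).length := by rw [hP.t_ident, hv]
    have hIw : I.sum = (D.s (P.ident w)).length := by rw [hP.s_ident, hw]
    have hOw : I.sum = (D.t (P.ident w)).length := by rw [hP.t_ident, hw]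
    have e := hP.ident_append v w
    rw [P.fusion_congr hI hO (e ▸ hI) (e ▸ hO) rfl rfl e.symm]
    have e' := hP.fusion_tensor [v.length] [v.length] I I (P.ident v) (P.ident w) hIv hOv hIw hOw
      (e ▸ hI) (e ▸ hO)
    refine (congrArg D.s e').trans ?_
    rw [hP.s_tensor, ih, (hP.exists_s_fusion_ident v).choose_spec]
    simp [prodOb]

theorem fusion_ident_eq (hP : P.Lawful) (I : List ℕ) (w : List D.Ob) (hI hO) :
    P.fusion I I (P.ident w) hI hO = P.ident ((I.splitLengths w).map hP.prodOb) := by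
  rw [hP.fusion_ident, hP.s_fusion_ident]

/-- Write `f` as `f ∘ Id` and fuse with `I` as the intermediate partition: the source becomes that
of a fused identity. This is how fusion of an arbitrary morphism is forced to use the same product
of objects. -/
theorem s_fusion (hP : P.Lawful) (I O : List ℕ) (f : D.Mor) (hI hO) :
    D.s (P.fusion I O f hI hO) = (I.splitLengths (D.s f)).map hP.prodOb := by
  have h := hP.t_ident (D.s f)
  have e := hP.comp_ident f h
  obtain ⟨h', e'⟩ := hP.fusion_comp I I O f (P.ident (D.s f)) h (e.symm ▸ hI) (e.symm ▸ hO)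
    (by rw [hP.s_ident, hI]) (by rw [hP.t_ident, hI]) hI hO
  rw [P.fusion_congr hI hO (e.symm ▸ hI) (e.symm ▸ hO) rfl rfl e.symm, e', hP.s_comp,
    hP.s_fusion_ident]

/-- Dual to `s_fusion`, with the identity composed on the target side; its fusion is again an
identity, so its target is its known source. -/
theorem t_fusion (hP : P.Lawful) (I O : List ℕ) (f : D.Mor) (hI hO) :
    D.t (P.fusion I O f hI hO) = (O.splitLengths (D.t f)).map hP.prodOb := by
  have h := (hP.s_ident (D.t f)).symm
  have e := hP.ident_comp f h
  obtain ⟨h', e'⟩ := hP.fusion_comp I O O (P.ident (D.t f)) f h (e.symm ▸ hI) (e.symm ▸ hO)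
    hI hO (by rw [hP.s_ident, hO]) (by rw [hP.t_ident, hO])
  rw [P.fusion_congr hI hO (e.symm ▸ hI) (e.symm ▸ hO) rfl rfl e.symm, e', hP.t_comp,
    hP.fusion_ident_eq, hP.t_ident]

/-- The strict tensor category of words in the objects of `D` whose morphisms are the morphisms
of `D`. -/
def wordCat (hP : P.Lawful) : StrictTensorCat.{u} where
  Ob := List D.Ob
  Mor := D.Mor
  s := D.s
  t := D.t
  id := P.ident
  comp := P.comp
  tensorOb v w := v ++ w
  unit := []
  tensor := P.tensor
  s_id := hP.s_ident
  t_id := hP.t_ident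
  s_comp := hP.s_comp
  t_comp := hP.t_comp
  id_comp x f h := by
    obtain rfl : D.t f = x := h.trans (hP.s_ident x)
    exact hP.ident_comp f h
  comp_id x f h := by
    obtain rfl : D.s f = x := h.symm.trans (hP.t_ident x)
    exact hP.comp_ident f h
  assoc := hP.comp_assoc
  tensorOb_assoc := List.append_assoc
  unit_tensorOb _ := rfl
  tensorOb_unit := List.append_nil
  s_tensor := hP.s_tensor
  t_tensor := hP.t_tensor
  tensor_id := hP.ident_append
  interchange := hP.interchange
  tensor_assoc := hP.tensor_assoc
  unit_tensor := hP.unit_tensor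
  tensor_unit := hP.tensor_unit

/-! ### Evaluation in the word category, followed by fusion. -/

theorem wordCat_prod_singletons (hP : P.Lawful) (w : List D.Ob) :
    hP.wordCat.prod (w.map fun x => [x]) = w := by
  induction w with
  | nil => rfl
  | cons x w ih => exact congrArg (x :: ·) ih

/-- The strict tensor functor sending a morphism of the free strict tensor category to its value
computed with the given operations. -/
noncomputable def evalFunctor (hP : P.Lawful) : freeTensorCat D ⟶ hP.wordCat :=
  freeLift (TensorScheme.Hom.mk (D := D) (E := StrictTensorCat.U.obj hP.wordCat)
    (fun x => [x])
    (fun f => StrictTensorCat.Prim.mk (V := hP.wordCat)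
      ((D.s f).map fun x => [x]) ((D.t f).map fun x => [x]) f
      (hP.wordCat_prod_singletons _).symm (hP.wordCat_prod_singletons _).symm)
    (fun _ => rfl) (fun _ => rfl))

theorem evalFunctor_obj (hP : P.Lawful) (w : List D.Ob) : hP.evalFunctor.obj w = w :=
  hP.wordCat_prod_singletons w

theorem evalFunctor_gen (hP : P.Lawful) (f : D.Mor) :
    hP.evalFunctor.mor (FreeMor.mk (.gen f)) = f := rfl

theorem sum_map_length_dom (hP : P.Lawful) (p : StrictTensorCat.Prim (freeTensorCat D)) :
    (p.dom.map List.length).sum = (D.s (hP.evalFunctor.mor p.mor)).length :=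
  sum_map_length_eq p.dom
    ((hP.evalFunctor.s_mor p.mor).trans ((hP.evalFunctor_obj _).trans p.s_mor))

theorem sum_map_length_cod (hP : P.Lawful) (p : StrictTensorCat.Prim (freeTensorCat D)) :
    (p.cod.map List.length).sum = (D.t (hP.evalFunctor.mor p.mor)).length :=
  sum_map_length_eq p.cod
    ((hP.evalFunctor.t_mor p.mor).trans ((hP.evalFunctor_obj _).trans p.t_mor))

theorem splitLengths_s_evalFunctor (hP : P.Lawful)
    (p : StrictTensorCat.Prim (freeTensorCat D)) :
    (p.dom.map List.length).splitLengths (D.s (hP.evalFunctor.mor p.mor)) = p.dom := by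
  have e : D.s (hP.evalFunctor.mor p.mor) = p.dom.flatten :=
    (hP.evalFunctor.s_mor p.mor).trans ((hP.evalFunctor_obj _).trans
      (p.s_mor.trans (freeTensorCat_prod D _)))
  exact (congrArg _ e).trans (List.splitLengths_map_length_flatten p.dom)

theorem splitLengths_t_evalFunctor (hP : P.Lawful)
    (p : StrictTensorCat.Prim (freeTensorCat D)) :
    (p.cod.map List.length).splitLengths (D.t (hP.evalFunctor.mor p.mor)) = p.cod := by
  have e : D.t (hP.evalFunctor.mor p.mor) = p.cod.flatten :=
    (hP.evalFunctor.t_mor p.mor).trans ((hP.evalFunctor_obj _).trans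
      (p.t_mor.trans (freeTensorCat_prod D _)))
  exact (congrArg _ e).trans (List.splitLengths_map_length_flatten p.cod)

/-- The evaluation of prime diagrams by means of the given operations. -/
noncomputable def evaluation (hP : P.Lawful) :
    StrictTensorCat.U.obj (freeTensorCat D) ⟶ D :=
  TensorScheme.Hom.mk (D := StrictTensorCat.U.obj (freeTensorCat D)) (E := D)
    hP.prodOb
    -- The morphism being fused is the image of `p.mor` under `evalFunctor`; the partitions are the
    -- lengths of the words in `p.dom` and `p.cod`.
    (fun p => P.fusion _ _ _ (hP.sum_map_length_dom p) (hP.sum_map_length_cod p))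
    (fun p => (hP.s_fusion _ _ _ _ _).trans
      (congrArg (List.map hP.prodOb) (hP.splitLengths_s_evalFunctor p)))
    (fun p => (hP.t_fusion _ _ _ _ _).trans
      (congrArg (List.map hP.prodOb) (hP.splitLengths_t_evalFunctor p)))

/-- In the free category a tensor product of words is their concatenation, so fusing a diagram
coarsens the partitions that evaluation will use. -/
theorem map_length_map_prod (I : List ℕ) (L : List (List D.Ob)) :
    ((I.splitLengths L).map (freeTensorCat D).prod).map List.length =
      coarsen I (L.map List.length) := by
  rw [coarsen, List.splitLengths_map, List.map_map]
  exact List.map_map.trans (List.map_congr_left fun w _ =>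
    (congrArg List.length (freeTensorCat_prod D w)).trans List.length_flatten)

/-- Evaluation is a functor followed by a fusion, so each clause combines strict functoriality with
the matching law for fusion: fused identities, tensor products, composites and iterated fusions. -/
theorem preservesOperations_evaluation (hP : P.Lawful) :
    PreservesOperations (freeTensorCat D).primOps P hP.evaluation := by
  constructor
  · intro w
    have e : hP.evalFunctor.mor ((freeTensorCat D).id ((freeTensorCat D).prod w)) =
        P.ident w.flatten :=
      (hP.evalFunctor.map_id _).trans
        (congrArg P.ident ((hP.evalFunctor_obj _).trans (freeTensorCat_prod D w)))
    have hs : (w.map List.length).sum = (D.s (P.ident w.flatten)).length := by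
      rw [hP.s_ident]
      exact List.length_flatten.symm
    have ht : (w.map List.length).sum = (D.t (P.ident w.flatten)).length := by
      rw [hP.t_ident]
      exact List.length_flatten.symm
    refine (P.fusion_congr _ _ hs ht rfl rfl e).trans ?_
    rw [hP.fusion_ident_eq]
    exact congrArg (fun L => P.ident (L.map hP.prodOb)) (List.splitLengths_map_length_flatten _)
  · intro p q
    have e := hP.evalFunctor.map_tensor (StrictTensorCat.Prim.mor p) (StrictTensorCat.Prim.mor q)
    have hs := List.sum_append.trans
      ((congrArg₂ (· + ·) (hP.sum_map_length_dom p) (hP.sum_map_length_dom q)).trans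
        (List.length_append.symm.trans (congrArg List.length (hP.s_tensor _ _).symm)))
    have ht := List.sum_append.trans
      ((congrArg₂ (· + ·) (hP.sum_map_length_cod p) (hP.sum_map_length_cod q)).trans
        (List.length_append.symm.trans (congrArg List.length (hP.t_tensor _ _).symm)))
    exact (P.fusion_congr _ _ hs ht List.map_append List.map_append e).trans
      (hP.fusion_tensor _ _ _ _ _ _ (hP.sum_map_length_dom p) (hP.sum_map_length_cod p)
        (hP.sum_map_length_dom q) (hP.sum_map_length_cod q) hs ht)
  · intro q p h
    have e := hP.evalFunctor.map_comp (StrictTensorCat.Prim.mor q) (StrictTensorCat.Prim.mor p)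
      ((StrictTensorCat.Prim.t_mor p).trans
        ((congrArg (freeTensorCat D).prod h).trans (StrictTensorCat.Prim.s_mor q).symm))
    have hm : (StrictTensorCat.Prim.cod p).map List.length =
      (StrictTensorCat.Prim.dom q).map List.length := congrArg (List.map List.length) h
    have hc : (p.cod.map List.length).sum = (D.s (hP.evalFunctor.mor q.mor)).length :=
      (congrArg List.sum hm).trans (hP.sum_map_length_dom q)
    -- The intermediate partition comes from the target of `p`; by composability it is also the
    -- source partition of `q`.
    obtain ⟨h', k⟩ := hP.fusion_comp (p.dom.map List.length) (p.cod.map List.length)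
      (q.cod.map List.length) (hP.evalFunctor.mor q.mor) (hP.evalFunctor.mor p.mor)
      _ ((hP.sum_map_length_dom p).trans (congrArg List.length (hP.s_comp _ _ _).symm))
      ((hP.sum_map_length_cod q).trans (congrArg List.length (hP.t_comp _ _ _).symm))
      (hP.sum_map_length_dom p) (hP.sum_map_length_cod p) hc (hP.sum_map_length_cod q)
    exact (P.fusion_congr _ _ _ _ rfl rfl e).trans (k.trans (P.comp_congr _ _
      (P.fusion_congr _ _ _ _ hm rfl rfl) rfl))
  · intro I O p hI hO
    have hI' : (coarsen I (p.dom.map List.length)).sum =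
        (D.s (hP.evalFunctor.mor p.mor)).length :=
      (sum_coarsen _ _ (hI.trans (List.length_map _).symm)).trans (hP.sum_map_length_dom p)
    have hO' : (coarsen O (p.cod.map List.length)).sum =
        (D.t (hP.evalFunctor.mor p.mor)).length :=
      (sum_coarsen _ _ (hO.trans (List.length_map _).symm)).trans (hP.sum_map_length_cod p)
    exact (P.fusion_congr _ _ hI' hO' (map_length_map_prod I _) (map_length_map_prod O _)
      rfl).trans (hP.fusion_fusion _ _ _ _ _ _ _ _ _ _ _).symm

/-- A generator evaluates to itself fused along blocks of length 1, hence to itself. The statement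
on objects is then read off from the sources of one-letter identities. -/
theorem freeUnit_comp_evaluation (hP : P.Lawful) : freeUnit D ≫ hP.evaluation = 𝟙 D := by
  have hl : ∀ w : List D.Ob, (w.map fun x => [x]).map List.length =
      List.replicate w.length 1 := fun w => by
    rw [List.map_map]
    exact List.map_const'
  have hmor : ∀ f : D.Mor, hP.evaluation.mor ((freeUnit D).mor f) = f := fun f =>
    (P.fusion_congr _ _ (by simp) (by simp) (hl _) (hl _) (hP.evalFunctor_gen f)).trans
      (hP.fusion_finest f (by simp) (by simp))
  refine TensorScheme.hom_ext (fun x => ?_) hmor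
  have e := congrArg D.s (hmor (P.ident [x]))
  rw [hP.evaluation.s_mor, (freeUnit D).s_mor, hP.s_ident] at e
  exact List.singleton_injective e

/-- The tensor manifold structure given by a lawful system of operations. -/
noncomputable def toTAlgStr (hP : P.Lawful) : TAlgStr D where
  str := hP.evaluation
  unit := (congrArg (· ≫ hP.evaluation) (tensorMonad_η_app D)).trans hP.freeUnit_comp_evaluation
  assoc := by
    let TD := StrictTensorCat.U.obj (freeTensorCat D)
    have hμ : PreservesOperations (freeTensorCat TD).primOps (freeTensorCat D).primOps
        (tensorMonad.μ.app D) := by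
      rw [tensorMonad_μ_app]
      exact StrictTensorCat.preservesOperations_map _
    -- Both composites out of `T (T D)` preserve operations, so it suffices to compare them on the
    -- generators, which are the prime diagrams of `T D`; there both reduce to `hP.evaluation`.
    refine PreservesOperations.hom_ext (D := TD) (hμ.trans hP.preservesOperations_evaluation)
      ((preservesOperations_tensorMonad_map (D := TD) hP.evaluation).trans
        hP.preservesOperations_evaluation) ?_
    have h₁ : freeUnit TD ≫ tensorMonad.μ.app D = 𝟙 TD := by
      rw [tensorMonad_μ_app]
      exact freeUnit_lift _
    calc freeUnit TD ≫ tensorMonad.μ.app D ≫ hP.evaluation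
        = (freeUnit TD ≫ tensorMonad.μ.app D) ≫ hP.evaluation := (Category.assoc _ _ _).symm
      _ = 𝟙 TD ≫ hP.evaluation := congrArg (· ≫ hP.evaluation) h₁
      _ = hP.evaluation := Category.id_comp _
      _ = hP.evaluation ≫ 𝟙 D := (Category.comp_id _).symm
      _ = hP.evaluation ≫ freeUnit D ≫ hP.evaluation :=
        congrArg (hP.evaluation ≫ ·) hP.freeUnit_comp_evaluation.symm
      _ = (hP.evaluation ≫ freeUnit D) ≫ hP.evaluation := (Category.assoc _ _ _).symm
      _ = (freeUnit TD ≫ tensorMonad.map hP.evaluation) ≫ hP.evaluation :=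
        congrArg (· ≫ hP.evaluation) (freeUnit_comp_map hP.evaluation).symm
      _ = freeUnit TD ≫ tensorMonad.map hP.evaluation ≫ hP.evaluation := Category.assoc _ _ _

/-- The same map `hP.evaluation` preserves operations both into the induced system and into `P`, and
it is a retraction. -/
theorem toTAlgStr_ops (hP : P.Lawful) : hP.toTAlgStr.ops = P :=
  Operations.eq_of_retract (freeUnit D) hP.evaluation hP.freeUnit_comp_evaluation
    hP.toTAlgStr.preservesOperations_str hP.preservesOperations_evaluation

end Operations.Lawful

theorem mainTheorem8 :
    (∀ D : TensorScheme.{u},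
      (∀ A : TAlgStr D, A.ops.Lawful) ∧
      (∀ P : Operations D, P.Lawful → ∃! A : TAlgStr D, A.ops = P)) ∧
    (∀ (D E : TensorScheme.{u}) (A : TAlgStr D) (B : TAlgStr E) (φ : D ⟶ E),
      IsTAlgHom A B φ ↔ PreservesOperations A.ops B.ops φ) :=
  ⟨fun _ => ⟨TAlgStr.lawful_ops, fun _ hP => ⟨hP.toTAlgStr, hP.toTAlgStr_ops, fun _ hA =>
    TAlgStr.ops_injective (hA.trans hP.toTAlgStr_ops.symm)⟩⟩,
    fun _ _ _ _ _ => ⟨PreservesOperations.of_isTAlgHom, PreservesOperations.isTAlgHom⟩⟩
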